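/- Work with smooth (resp. complex) manifolds, i.e. finite-dimensional, Hausdorff and second countable, and with smooth (resp. holomorphic) maps. For a Lie groupoid $\Gamma\rightrightarrows M$ with source $s$ and target $t$, the product $\gamma_1\gamma_2$ is defined when $t(\gamma_1)=s(\gamma_2)$; left actions $\gamma\cdot x$ on $p:X\to M$ are defined when $t(\gamma)=p(x)$, with $p(\gamma\cdot x)=s(\gamma)$, and right actions $x\cdot\gamma'$ on $p':X\to M'$ when $p'(x)=s(\gamma')$, with $p'(x\cdot\gamma')=t(\gamma')$. A subset $S\subset M$ is $\Gamma$-stable if $t(\gamma)\in S\Leftrightarrow s(\gamma)\in S$ for all $\gamma\in\Gamma$. A Morita equivalence $\mathcal X$ between $\Gamma\rightrightarrows M$ and $\Gamma'\rightrightarrows M'$ is a manifold $X$ with surjective submersions $p:X\to M$, $p':X\to M'$ and commuting left $\Gamma$- and right $\Gamma'$-actions (along $p$ and $p'$) which preserve the fibres of $p'$ and $p$ respectively, and which are proper, free and transitive on these fibres. For $S\subset M$ put $\underline{\mathcal X}(S)=p'(p^{-1}(S))$. A Lie subgroupoid $R\rightrightarrows L$ of $\Gamma\rightrightarrows M$ is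 a Lie groupoid with injective immersions $R\to\Gamma$, $L\to M$ compatible with all structural maps. A Morita equivalence of Lie subgroupoids $(\mathcal X,\mathcal Y,\mathfrak i)$ between $R\rightrightarrows L$ (in $\Gamma\rightrightarrows M$) and $R'\rightrightarrows L'$ (in $\Gamma'\rightrightarrows M'$) consists of a Morita equivalence $\mathcal X$ between $\Gamma$ and $\Gamma'$, a Morita equivalence $\mathcal Y$ between $R$ and $R'$, and an injective immersion $\mathfrak i:Y\to X$ compatible with the projections $p,p'$ and satisfying $\mathfrak i(r\cdot y\cdot r')=r\cdot\mathfrak i(y)\cdot r'$. Let $\mathcal S\subset M$ be a $\Gamma$-stable embedded submanifold. A Lie subgroupoid $R\rightrightarrows L$ is *in $\mathcal S$* if (a) $L\cap\mathcal S$ is dense in $L$; (b) $T_m\mathcal S=T_mF_m+T_mL$ for all $m\in L\cap\mathcal S$, where $F_m$ is the $\Gamma$-orbit of $m$; (c) $L$ meets every $\Gamma$-orbit contained in $\mathcal S$. A Lie subgroupoid in $\mathcal S$ is *surjective in $\overline{\mathcal S}$* if $L$ meets every $\Gamma$-orbit contained in $\overline{\mathcal S}$; *full in $\mathcal S$* if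 every arrow of $\Gamma$ with source and target in $L\cap\mathcal S$ belongs to $R$; *proper* if for every compact $K\subset\overline{\mathcal S}$ the quotient topological space $R\backslash\Gamma_L^K$ is compact (every open cover has a finite subcover), where $\Gamma_L^K$ is the space of arrows with source in $L$ and target in $K$, topologized as a subspace of $L\times\Gamma$. **Proposition.** Let $(\mathcal X,\mathcal Y,\mathfrak i)$ be a Morita equivalence of Lie subgroupoids between a Lie subgroupoid $R\rightrightarrows L$ of $\Gamma\rightrightarrows M$ and a Lie subgroupoid $R'\rightrightarrows L'$ of $\Gamma'\rightrightarrows M'$. Let $\mathcal S$ be a $\Gamma$-stable embedded submanifold of $M$ and $\mathcal S'=\underline{\mathcal X}(\mathcal S)$. Then $\mathcal S'$ is a $\Gamma'$-stable embedded submanifold of $M'$, and: 1. $R\rightrightarrows L$ is in $\mathcal S$ if and only if $R'\rightrightarrows L'$ is in $\mathcal S'$; 2. $R\rightrightarrows L$ is surjective in $\overline{\mathcal S}$ if and only if $R'\rightrightarrows L'$ is surjective in $\overline{\mathcal S'}$; 3. $R\rightrightarrows L$ is full in $\mathcal S$ if and only if $R'\rightrightarrows L'$ is full in $\mathcal S'$;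 4. $R\rightrightarrows L$ is proper (with respect to $\mathcal S$) if and only if $R'\rightrightarrows L'$ is proper (with respect to $\mathcal S'$). -/

import Mathlib

open Set Filter Topology
open scoped Manifold ContDiff

universe v u w

/-! ### Manifolds -/

/-- A finite-dimensional Hausdorff second countable manifold without boundary over `𝕜`:
a smooth manifold for `𝕜 = ℝ`, a complex manifold for `𝕜 = ℂ` (over `ℂ`, maps of class `C^∞`
are exactly the holomorphic ones). -/
structure Mfd (𝕜 : Type v) [RCLike 𝕜] : Type (max v (u + 1)) where
  carrier : Type u
  dim : ℕ
  [top : TopologicalSpace carrier]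
  [charted : ChartedSpace (EuclideanSpace 𝕜 (Fin dim)) carrier]
  [smooth : IsManifold 𝓘(𝕜, EuclideanSpace 𝕜 (Fin dim)) ∞ carrier]
  [hausdorff : T2Space carrier]
  [secondCountable : SecondCountableTopology carrier]

namespace Mfd

variable {𝕜 : Type v} [RCLike 𝕜]

instance : CoeSort (Mfd.{v, u} 𝕜) (Type u) := ⟨Mfd.carrier⟩

attribute [instance] Mfd.top Mfd.charted Mfd.smooth Mfd.hausdorff Mfd.secondCountable

/-- The model vector space. In Mathlib every tangent space `TangentSpace M.I m` is, by definition,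
this vector space (through the preferred chart at `m`). -/
abbrev E (M : Mfd.{v, u} 𝕜) : Type v := EuclideanSpace 𝕜 (Fin M.dim)

/-- The model with corners (without boundary) of `M`. -/
noncomputable abbrev I (M : Mfd.{v, u} 𝕜) : ModelWithCorners 𝕜 M.E M.E := 𝓘(𝕜, M.E)

/-- `S` is an embedded submanifold of `M`: near each of its points, `S` is the zero set of a
submersion to some `𝕜 ^ k`. -/
def IsEmbeddedSubmanifold (M : Mfd.{v, u} 𝕜) (S : Set M) : Prop :=
  ∀ m ∈ S, ∃ U : Set M, IsOpen U ∧ m ∈ U ∧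
    ∃ (k : ℕ) (f : M → EuclideanSpace 𝕜 (Fin k)),
      ContMDiffOn M.I 𝓘(𝕜, EuclideanSpace 𝕜 (Fin k)) ∞ f U ∧
      (∀ x ∈ U, Function.Surjective (mfderiv M.I 𝓘(𝕜, EuclideanSpace 𝕜 (Fin k)) f x)) ∧
      S ∩ U = {x ∈ U | f x = 0}

/-- The tangent space `T_m S ⊆ T_m M` of an embedded submanifold `S` at `m ∈ S`: the vectors which
are velocities at `0` of smooth (holomorphic) paths in `S` starting at `m`. (These velocities form
a vector space when `S` is an embedded submanifold, so that taking the span adds nothing.) -/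
def tangentOfSubset (M : Mfd.{v, u} 𝕜) (S : Set M) (m : M) : Submodule 𝕜 M.E :=
  Submodule.span 𝕜 {u : M.E | ∃ c : 𝕜 → M,
    c 0 = m ∧ ContMDiffAt 𝓘(𝕜, 𝕜) M.I ∞ c 0 ∧ (∀ᶠ ε in 𝓝 (0 : 𝕜), c ε ∈ S) ∧
      mfderiv 𝓘(𝕜, 𝕜) M.I c 0 (1 : 𝕜) = u}

end Mfd

/-! ### Lie groupoids -/

/-- A Lie groupoid `Γ ⇉ M` (with `Γ = Arr`, `M = Obj`). The product `g * h` is defined when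
`tgt g = src h`; it is encoded by a function `mul` on all pairs, whose values on non-composable
pairs are irrelevant. The set of composable pairs being an embedded submanifold of `Γ × Γ`,
smoothness of the product on it is smoothness `ContMDiffOn` this set. -/
structure LieGroupoid (𝕜 : Type v) [RCLike 𝕜] : Type (max v (u + 1)) where
  Arr : Mfd.{v, u} 𝕜
  Obj : Mfd.{v, u} 𝕜
  src : Arr → Obj
  tgt : Arr → Obj
  unit : Obj → Arr
  mul : Arr → Arr → Arr
  inv : Arr → Arr
  src_unit : ∀ m, src (unit m) = m
  tgt_unit : ∀ m, tgt (unit m) = m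
  src_mul : ∀ g h, tgt g = src h → src (mul g h) = src g
  tgt_mul : ∀ g h, tgt g = src h → tgt (mul g h) = tgt h
  mul_assoc : ∀ g h k, tgt g = src h → tgt h = src k → mul (mul g h) k = mul g (mul h k)
  unit_mul : ∀ g, mul (unit (src g)) g = g
  mul_unit : ∀ g, mul g (unit (tgt g)) = g
  src_inv : ∀ g, src (inv g) = tgt g
  tgt_inv : ∀ g, tgt (inv g) = src g
  mul_inv : ∀ g, mul g (inv g) = unit (src g)
  inv_mul : ∀ g, mul (inv g) g = unit (tgt g)
  submersion_src : Manifold.IsSubmersion Arr.I Obj.I ∞ src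
  submersion_tgt : Manifold.IsSubmersion Arr.I Obj.I ∞ tgt
  smooth_unit : ContMDiff Obj.I Arr.I ∞ unit
  smooth_inv : ContMDiff Arr.I Arr.I ∞ inv
  smooth_mul : ContMDiffOn (Arr.I.prod Arr.I) Arr.I ∞
    (fun q : Arr × Arr => mul q.1 q.2) {q | tgt q.1 = src q.2}

namespace LieGroupoid

variable {𝕜 : Type v} [RCLike 𝕜] (Γ : LieGroupoid.{v, u} 𝕜)

/-- The orbit of `m`. -/
def orbit (m : Γ.Obj) : Set Γ.Obj := {m' | ∃ g : Γ.Arr, Γ.src g = m ∧ Γ.tgt g = m'}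

/-- `Γ`-stable subsets of the unit manifold. -/
def IsStable (S : Set Γ.Obj) : Prop := ∀ g : Γ.Arr, Γ.tgt g ∈ S ↔ Γ.src g ∈ S

/-- The tangent space at `m` of the orbit `F_m` through `m`. The manifold structure of `F_m` is
the one for which `tgt : src⁻¹(m) → F_m` is a submersion, so that `T_m F_m` is the image under the
differential of `tgt` of the tangent space `ker d(src)` of `src⁻¹(m)` at the unit of `m`. -/
noncomputable def orbitTangent (m : Γ.Obj) : Submodule 𝕜 Γ.Obj.E :=
  Submodule.map
    (mfderiv Γ.Arr.I Γ.Obj.I Γ.tgt (Γ.unit m) : Γ.Arr.E →L[𝕜] Γ.Obj.E).toLinearMap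
    (LinearMap.ker
      (mfderiv Γ.Arr.I Γ.Obj.I Γ.src (Γ.unit m) : Γ.Arr.E →L[𝕜] Γ.Obj.E).toLinearMap)

end LieGroupoid

/-! ### Modules and Morita equivalences -/

/-- A left action of `Γ` on `X` with moment map `p`: `γ · x` is defined when `tgt γ = p x`
(the values of `act` on other pairs are irrelevant). -/
structure LeftModule {𝕜 : Type v} [RCLike 𝕜] (Γ : LieGroupoid.{v, u} 𝕜) (X : Mfd.{v, w} 𝕜)
    (p : X → Γ.Obj) where
  act : Γ.Arr → X → X
  moment_act : ∀ g x, Γ.tgt g = p x → p (act g x) = Γ.src g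
  unit_act : ∀ x, act (Γ.unit (p x)) x = x
  mul_act : ∀ g h x, Γ.tgt g = Γ.src h → Γ.tgt h = p x → act (Γ.mul g h) x = act g (act h x)
  smooth_act : ContMDiffOn (Γ.Arr.I.prod X.I) X.I ∞
    (fun q : Γ.Arr × X => act q.1 q.2) {q | Γ.tgt q.1 = p q.2}

/-- A right action of `Γ` on `X` with moment map `p`: `x · γ` is defined when `p x = src γ`
(the values of `act` on other pairs are irrelevant). -/
structure RightModule {𝕜 : Type v} [RCLike 𝕜] (Γ : LieGroupoid.{v, u} 𝕜) (X : Mfd.{v, w} 𝕜)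
    (p : X → Γ.Obj) where
  act : X → Γ.Arr → X
  moment_act : ∀ x g, p x = Γ.src g → p (act x g) = Γ.tgt g
  act_unit : ∀ x, act x (Γ.unit (p x)) = x
  act_mul : ∀ x g h, p x = Γ.src g → Γ.tgt g = Γ.src h → act x (Γ.mul g h) = act (act x g) h
  smooth_act : ContMDiffOn (X.I.prod Γ.Arr.I) X.I ∞
    (fun q : X × Γ.Arr => act q.1 q.2) {q | p q.1 = Γ.src q.2}

/-- A Morita equivalence between `Γ ⇉ M` and `Γ' ⇉ M'`: a manifold `X` with surjective submersions
`p : X → M` and `p' : X → M'`, commuting left `Γ`- and right `Γ'`-actions preserving the fibres of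
`p'` and `p` respectively, both actions being proper, free and transitive on these fibres. -/
structure LieMoritaEquivalence {𝕜 : Type v} [RCLike 𝕜] (Γ Γ' : LieGroupoid.{v, u} 𝕜) :
    Type (max v u (w + 1)) where
  X : Mfd.{v, w} 𝕜
  p : X → Γ.Obj
  p' : X → Γ'.Obj
  submersion_p : Manifold.IsSubmersion X.I Γ.Obj.I ∞ p
  submersion_p' : Manifold.IsSubmersion X.I Γ'.Obj.I ∞ p'
  surjective_p : Function.Surjective p
  surjective_p' : Function.Surjective p'
  left : LeftModule Γ X p
  right : RightModule Γ' X p'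
  p'_left : ∀ g x, Γ.tgt g = p x → p' (left.act g x) = p' x
  p_right : ∀ x g', p' x = Γ'.src g' → p (right.act x g') = p x
  comm : ∀ g x g', Γ.tgt g = p x → p' x = Γ'.src g' →
    right.act (left.act g x) g' = left.act g (right.act x g')
  proper_left : IsProperMap
    (fun q : {q : Γ.Arr × X // Γ.tgt q.1 = p q.2} => (left.act q.1.1 q.1.2, q.1.2))
  proper_right : IsProperMap
    (fun q : {q : X × Γ'.Arr // p' q.1 = Γ'.src q.2} => (q.1.1, right.act q.1.1 q.1.2))
  free_left : ∀ g x, Γ.tgt g = p x → left.act g x = x → g = Γ.unit (p x)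
  free_right : ∀ x g', p' x = Γ'.src g' → right.act x g' = x → g' = Γ'.unit (p' x)
  transitive_left : ∀ x y, p' x = p' y → ∃ g, Γ.tgt g = p x ∧ left.act g x = y
  transitive_right : ∀ x y, p x = p y → ∃ g', p' x = Γ'.src g' ∧ right.act x g' = y

/-- The correspondence `S ↦ p'(p⁻¹(S))` from `Γ`-stable subsets to `Γ'`-stable subsets. -/
def LieMoritaEquivalence.image {𝕜 : Type v} [RCLike 𝕜] {Γ Γ' : LieGroupoid.{v, u} 𝕜}
    (Φ : LieMoritaEquivalence.{v, u, w} Γ Γ') (S : Set Γ.Obj) : Set Γ'.Obj :=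
  Φ.p' '' (Φ.p ⁻¹' S)

/-! ### Lie subgroupoids -/

/-- A Lie subgroupoid `R ⇉ L` of `Γ ⇉ M`: a Lie groupoid `R ⇉ L` with injective immersions
`R → Γ` and `L → M` compatible with all the structural maps. Embedded submanifolds are the case in
which these two maps are moreover topological embeddings. -/
structure LieSubgroupoid {𝕜 : Type v} [RCLike 𝕜] (Γ : LieGroupoid.{v, u} 𝕜) :
    Type (max v (u + 1)) where
  gpd : LieGroupoid.{v, u} 𝕜
  inclArr : gpd.Arr → Γ.Arr
  inclObj : gpd.Obj → Γ.Obj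
  immersion_arr : Manifold.IsImmersion gpd.Arr.I Γ.Arr.I ∞ inclArr
  immersion_obj : Manifold.IsImmersion gpd.Obj.I Γ.Obj.I ∞ inclObj
  injective_arr : Function.Injective inclArr
  injective_obj : Function.Injective inclObj
  src_incl : ∀ r, Γ.src (inclArr r) = inclObj (gpd.src r)
  tgt_incl : ∀ r, Γ.tgt (inclArr r) = inclObj (gpd.tgt r)
  unit_incl : ∀ l, inclArr (gpd.unit l) = Γ.unit (inclObj l)
  mul_incl : ∀ r₁ r₂, gpd.tgt r₁ = gpd.src r₂ →
    inclArr (gpd.mul r₁ r₂) = Γ.mul (inclArr r₁) (inclArr r₂)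
  inv_incl : ∀ r, inclArr (gpd.inv r) = Γ.inv (inclArr r)

namespace LieSubgroupoid

variable {𝕜 : Type v} [RCLike 𝕜] {Γ : LieGroupoid.{v, u} 𝕜} (R : LieSubgroupoid Γ)

/-- `L` intersects transversally the `Γ`-orbits contained in `S`:
`T_m S = T_m F_m + T_m L` for all `m ∈ L ∩ S`. -/
def IsTransverse (S : Set Γ.Obj) : Prop :=
  ∀ l : R.gpd.Obj, R.inclObj l ∈ S →
    Γ.Obj.tangentOfSubset S (R.inclObj l) =
      Γ.orbitTangent (R.inclObj l) ⊔
        LinearMap.range (mfderiv R.gpd.Obj.I Γ.Obj.I R.inclObj l :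
          R.gpd.Obj.E →L[𝕜] Γ.Obj.E).toLinearMap

/-- `L` meets every `Γ`-orbit contained in `T`. -/
def MeetsOrbits (T : Set Γ.Obj) : Prop :=
  ∀ m : Γ.Obj, Γ.orbit m ⊆ T → (range R.inclObj ∩ Γ.orbit m).Nonempty

/-- `R ⇉ L` is a Lie subgroupoid in `S`. -/
structure IsIn (S : Set Γ.Obj) : Prop where
  dense : Dense (R.inclObj ⁻¹' S)
  transverse : R.IsTransverse S
  meets : R.MeetsOrbits S

/-- `R ⇉ L` is a Lie subgroupoid in `S` which is surjective in the closure of `S`. -/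
structure IsSurjectiveIn (S : Set Γ.Obj) : Prop where
  isIn : R.IsIn S
  meets_closure : R.MeetsOrbits (closure S)

/-- `R ⇉ L` is a Lie subgroupoid in `S` which is full in `S`: the arrows of `R` and the arrows
of `Γ` with source and target in `L ∩ S` are the same. -/
structure IsFullIn (S : Set Γ.Obj) : Prop where
  isIn : R.IsIn S
  full : {g : Γ.Arr | g ∈ range R.inclArr ∧
        Γ.src g ∈ range R.inclObj ∩ S ∧ Γ.tgt g ∈ range R.inclObj ∩ S} =
      {g : Γ.Arr | Γ.src g ∈ range R.inclObj ∩ S ∧ Γ.tgt g ∈ range R.inclObj ∩ S}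

/-- The space `Γ_L^K` of arrows with source in `L` and target in `K`, as a subspace of `L × Γ`
(when `L` is embedded, this is the subspace `src⁻¹(L) ∩ tgt⁻¹(K)` of `Γ`). -/
abbrev ArrowsTo (K : Set Γ.Obj) :=
  {q : R.gpd.Obj × Γ.Arr // R.inclObj q.1 = Γ.src q.2 ∧ Γ.tgt q.2 ∈ K}

/-- Two elements of `Γ_L^K` are related when the second is `r · γ`, where `γ` is the first. -/
def actRel (K : Set Γ.Obj) (a b : R.ArrowsTo K) : Prop :=
  ∃ r : R.gpd.Arr, R.gpd.tgt r = a.1.1 ∧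
    b.1 = (R.gpd.src r, Γ.mul (R.inclArr r) a.1.2)

/-- `R ⇉ L` is a Lie subgroupoid in `S` which is proper: for every compact subset `K` of the
closure of `S`, the quotient topological space `R \ Γ_L^K` is compact. -/
structure IsProperIn (S : Set Γ.Obj) : Prop where
  isIn : R.IsIn S
  compact : ∀ K : Set Γ.Obj, IsCompact K → K ⊆ closure S → CompactSpace (Quot (R.actRel K))

end LieSubgroupoid

/-- A Morita equivalence `(X, Y, i)` between a Lie subgroupoid `R ⇉ L` of `Γ ⇉ M` and a Lie
subgroupoid `R' ⇉ L'` of `Γ' ⇉ M'`. -/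
structure SubgroupoidMoritaEquivalence {𝕜 : Type v} [RCLike 𝕜] {Γ Γ' : LieGroupoid.{v, u} 𝕜}
    (R : LieSubgroupoid Γ) (R' : LieSubgroupoid Γ') : Type (max v u (w + 1)) where
  X : LieMoritaEquivalence.{v, u, w} Γ Γ'
  Y : LieMoritaEquivalence.{v, u, w} R.gpd R'.gpd
  i : Y.X → X.X
  immersion_i : Manifold.IsImmersion Y.X.I X.X.I ∞ i
  injective_i : Function.Injective i
  p_i : ∀ y, X.p (i y) = R.inclObj (Y.p y)
  p'_i : ∀ y, X.p' (i y) = R'.inclObj (Y.p' y)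
  equivariant : ∀ r y r', R.gpd.tgt r = Y.p y → Y.p' y = R'.gpd.src r' →
    i (Y.right.act (Y.left.act r y) r') =
      X.right.act (X.left.act (R.inclArr r) (i y)) (R'.inclArr r')

/-!
Every condition is pulled back along the surjective submersions `p` and `p'` to `X`, or along
`p ∘ i` and `p' ∘ i` to `Y`, where it reads the same for both groupoids because
`p⁻¹ S = p'⁻¹ S'` when `S` is stable. Together with the inverse Morita equivalence this gives each
equivalence.

For transversality the infinitesimal input is `T F = dp (ker dp')` at `p x`, for the orbit `F` of
`p x`: the orbit map `γ ↦ γ · x` onto the fibre of `p'` is a submersion at the unit. Indeed, by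
equivariance under translation by local sections of the groupoid, its rank near the unit is at most
its rank at the unit, so the constant rank theorem applies; and it has a right inverse which is
continuous at the base point, by transitivity, freeness and properness. The condition then becomes
`T (p⁻¹ S) = ker dp + ker dp' + range di`, which is symmetric.

For properness, a compact subset of the closure of `S'` is `p' C` for a compact `C ⊆ X`, and
`R' \ Γ'_{L'}^{p' C}` is a continuous image of the fibre product of `R \ Γ_L^{p C}` and `C` over
`p C`, which is closed in a product of compact spaces.
-/

section ConstantRank

theorem isOpen_setOf_surjective {𝕜 E F : Type*} [NontriviallyNormedField 𝕜] [CompleteSpace 𝕜]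
    [NormedAddCommGroup E] [NormedSpace 𝕜 E] [NormedAddCommGroup F] [NormedSpace 𝕜 F]
    [FiniteDimensional 𝕜 F] : IsOpen {L : E →L[𝕜] F | Function.Surjective L} := by
  convert isOpen_setOfPred_nat_le_rank (𝕜 := 𝕜) (E := E) (F := F) (Module.finrank 𝕜 F) using 1
  ext L
  change Function.Surjective (L : E →ₗ[𝕜] F) ↔ (Module.finrank 𝕜 F : Cardinal) ≤ LinearMap.rank _
  rw [← LinearMap.range_eq_top, LinearMap.rank, ← Module.finrank_eq_rank, Nat.cast_le]
  exact ⟨fun h => by rw [h, finrank_top],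
    fun h => Submodule.eq_top_of_finrank_eq ((Submodule.finrank_le _).antisymm h)⟩

theorem eventually_surjective_of_continuousAt {𝕜 E F T : Type*} [NontriviallyNormedField 𝕜]
    [CompleteSpace 𝕜] [NormedAddCommGroup E] [NormedSpace 𝕜 E] [NormedAddCommGroup F]
    [NormedSpace 𝕜 F] [FiniteDimensional 𝕜 F] [TopologicalSpace T] {L : T → E →L[𝕜] F} {a : T}
    (hL : ContinuousAt L a) (hs : Function.Surjective (L a)) :
    ∀ᶠ u in 𝓝 a, Function.Surjective (L u) :=
  hL.eventually_mem (isOpen_setOf_surjective.mem_nhds hs)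

theorem apply_eq_zero_of_surjective_comp_of_finrank_range_le {K E V W : Type*} [DivisionRing K]
    [AddCommGroup E] [Module K E] [AddCommGroup V] [Module K V] [AddCommGroup W] [Module K W]
    {π : V →ₗ[K] W} {L : E →ₗ[K] V} [FiniteDimensional K (LinearMap.range L)]
    (hs : Function.Surjective (π ∘ₗ L))
    (hr : Module.finrank K (LinearMap.range L) ≤ Module.finrank K W)
    {v : E} (hv : π (L v) = 0) : L v = 0 := by
  have hs' : Function.Surjective (π ∘ₗ (LinearMap.range L).subtype) := fun w => by
    obtain ⟨u, rfl⟩ := hs w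
    exact ⟨⟨L u, u, rfl⟩, rfl⟩
  have := Module.Finite.of_surjective _ hs'
  have hinj := (LinearMap.injective_iff_surjective_of_finrank_eq_finrank
    (hr.antisymm (LinearMap.finrank_le_finrank_of_surjective hs'))).2 hs'
  exact congrArg Subtype.val (hinj (a₁ := ⟨L v, v, rfl⟩) (a₂ := 0) (by simpa using hv))

variable {𝕜 : Type*} [RCLike 𝕜]
  {E : Type*} [NormedAddCommGroup E] [NormedSpace 𝕜 E]
  {V : Type*} [NormedAddCommGroup V] [NormedSpace 𝕜 V]
  {W : Type*} [NormedAddCommGroup W] [NormedSpace 𝕜 W]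

theorem eventually_eq_of_eventually_hasFDerivAt_zero {f : E → V} {a : E}
    (hf : ∀ᶠ u in 𝓝 a, HasFDerivAt f (0 : E →L[𝕜] V) u) : ∀ᶠ u in 𝓝 a, f u = f a := by
  let _ : NormedSpace ℝ E := NormedSpace.restrictScalars ℝ 𝕜 E
  obtain ⟨s, hs, hso, has⟩ := eventually_nhds_iff.1 hf
  exact mem_of_superset ((hso.isOpen_inter_preimage_of_fderiv_eq_zero
    (fun u hu => (hs u hu).differentiableAt.differentiableWithinAt)
    (fun u hu => (hs u hu).fderiv) {f a}).mem_nhds ⟨has, rfl⟩) fun _ hu => hu.2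

theorem eventually_differentiableAt {f : E → V} {a : E} (hf : ContDiffAt 𝕜 1 f a) :
    ∀ᶠ u in 𝓝 a, DifferentiableAt 𝕜 f u :=
  (hf.eventually (by simp)).mono fun _ h => h.differentiableAt (by simp)

theorem eventually_eq_of_ker_fderiv_leftFun_le {F : Type*} [NormedAddCommGroup F]
    [NormedSpace 𝕜 F] [CompleteSpace E] [CompleteSpace F] [CompleteSpace W]
    (φ : ImplicitFunctionData 𝕜 E W F) (hl : ContDiffAt 𝕜 1 φ.leftFun φ.pt)
    (hr : ContDiffAt 𝕜 1 φ.rightFun φ.pt) {f : E → V}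
    (hf : ∀ᶠ u in 𝓝 φ.pt, DifferentiableAt 𝕜 f u)
    (hker : ∀ᶠ u in 𝓝 φ.pt, ∀ v, fderiv 𝕜 φ.leftFun u v = 0 → fderiv 𝕜 f u v = 0) :
    ∀ᶠ u in 𝓝 φ.pt, φ.leftFun u = φ.leftFun φ.pt → f u = f φ.pt := by
  set a := φ.pt
  set ψ := φ.implicitFunction (φ.leftFun a)
  have hψa : ψ (φ.rightFun a) = a := φ.implicitFunction_apply_image.self_of_nhds
  have hψ : ContDiffAt 𝕜 1 ψ (φ.rightFun a) :=
    ContDiffAt.comp (g := φ.implicitFunction.uncurry) (f := (φ.leftFun a, ·)) (φ.rightFun a)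
      (φ.contDiffAt_implicitFunction hl hr (by simp)) (by fun_prop)
  have hhψ : ∀ᶠ k in 𝓝 (φ.rightFun a), φ.leftFun (ψ k) = φ.leftFun a :=
    (Continuous.prodMk_right (φ.leftFun a)).continuousAt.eventually φ.leftFun_implicitFunction
  have hψt : Tendsto ψ (𝓝 (φ.rightFun a)) (𝓝 a) := by
    simpa only [ContinuousAt, hψa] using hψ.continuousAt
  have hconst : ∀ᶠ k in 𝓝 (φ.rightFun a), f (ψ k) = f (ψ (φ.rightFun a)) := by
    refine eventually_eq_of_eventually_hasFDerivAt_zero (𝕜 := 𝕜) ?_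
    filter_upwards [hψt.eventually ((hf.and (eventually_differentiableAt hl)).and hker),
      eventually_differentiableAt hψ, hhψ.eventually_nhds] with k ⟨⟨hfk, hhk⟩, hkerk⟩ hψk hhψk
    have hzero := (hhk.hasFDerivAt.comp k hψk.hasFDerivAt).unique
      ((hasFDerivAt_const _ k).congr_of_eventuallyEq hhψk)
    exact (hfk.hasFDerivAt.comp k hψk.hasFDerivAt).congr_fderiv
      (ContinuousLinearMap.ext fun v => hkerk _ (congrArg (· v) hzero))
  filter_upwards [φ.leftFun_eq_iff_implicitFunction,
    hr.continuousAt.eventually hconst] with u hu huf huh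
  rwa [hψa, show ψ (φ.rightFun u) = u from hu.1 huh] at huf

theorem eventually_eq_of_ker_fderiv_le [CompleteSpace E] [FiniteDimensional 𝕜 W]
    {f : E → V} {h : E → W} {a : E} (hf : ∀ᶠ u in 𝓝 a, DifferentiableAt 𝕜 f u)
    (hh : ContDiffAt 𝕜 1 h a) (hs : Function.Surjective (fderiv 𝕜 h a))
    (hker : ∀ᶠ u in 𝓝 a, ∀ v, fderiv 𝕜 h u v = 0 → fderiv 𝕜 f u v = 0) :
    ∀ᶠ u in 𝓝 a, h u = h a → f u = f a := by
  have := FiniteDimensional.complete 𝕜 W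
  have : CompleteSpace (fderiv 𝕜 h a).ker := (fderiv 𝕜 h a).isClosed_ker.completeSpace_coe
  exact eventually_eq_of_ker_fderiv_leftFun_le
    ((hh.hasStrictFDerivAt (by simp)).implicitFunctionDataOfComplemented _ _
      (LinearMap.range_eq_top.2 hs)
      (fderiv 𝕜 h a).ker_closedComplemented_of_finiteDimensional_range) hh
    ((ContinuousLinearMap.contDiff _).comp (contDiff_id.sub contDiff_const)).contDiffAt hf hker

theorem surjective_fderiv_of_finrank_range_le [FiniteDimensional 𝕜 E] {f : E → V} {a : E}
    (hf : ContDiffAt 𝕜 1 f a)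
    (hrank : ∀ᶠ u in 𝓝 a, Module.finrank 𝕜 (fderiv 𝕜 f u).range ≤
      Module.finrank 𝕜 (fderiv 𝕜 f a).range)
    {g : V → E} (hg : Tendsto g (𝓝 (f a)) (𝓝 a)) (hfg : ∀ᶠ y in 𝓝 (f a), f (g y) = y) :
    Function.Surjective (fderiv 𝕜 f a) := by
  have := FiniteDimensional.complete 𝕜 E
  obtain ⟨π, hπ⟩ := Submodule.ClosedComplemented.of_finiteDimensional (fderiv 𝕜 f a).range
  have hπ' (u : E) : π (fderiv 𝕜 f a u) = fderiv 𝕜 f a u :=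
    congrArg Subtype.val (hπ ⟨fderiv 𝕜 f a u, u, rfl⟩)
  have hfd := eventually_differentiableAt hf
  have hd : ∀ᶠ u in 𝓝 a, fderiv 𝕜 (fun u => π (f u)) u = π.comp (fderiv 𝕜 f u) :=
    hfd.mono fun u hu => (π.hasFDerivAt.comp u hu.hasFDerivAt).fderiv
  have hs : Function.Surjective (π.comp (fderiv 𝕜 f a)) := by
    rintro ⟨_, u, rfl⟩
    exact ⟨u, Subtype.ext (hπ' u)⟩
  -- `f` factors locally through `π ∘ f`, a submersion with the same rank; applied to `g` along
  -- the line `f a + ε v`, this leaves no room for a vector `v ≠ 0` in the kernel of `π`.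
  have hlevel : ∀ᶠ u in 𝓝 a, π (f u) = π (f a) → f u = f a := by
    refine eventually_eq_of_ker_fderiv_le hfd (π.contDiff.contDiffAt.comp a hf)
      (by rwa [hd.self_of_nhds]) ?_
    filter_upwards [hd, hrank, eventually_surjective_of_continuousAt
      (continuousAt_const.clm_comp (hf.continuousAt_fderiv (by simp))) hs] with u hdu hru hsu v hv
    rw [hdu] at hv
    exact apply_eq_zero_of_surjective_comp_of_finrank_range_le (π := π.toLinearMap)
      (L := (fderiv 𝕜 f u).toLinearMap) hsu hru hv
  have hker : ∀ v, π v = 0 → v = 0 := by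
    intro v hv
    have hline : Tendsto (fun ε : 𝕜 => f a + ε • v) (𝓝 0) (𝓝 (f a)) := by
      simpa using (by fun_prop : Continuous fun ε : 𝕜 => f a + ε • v).tendsto 0
    have hev : ∀ᶠ ε : 𝕜 in 𝓝 0, ε • v = 0 := by
      filter_upwards [hline.eventually (hfg.and (hg.eventually hlevel))] with ε ⟨hε, hε'⟩
      rw [hε] at hε'
      simpa using hε' (by simp [hv])
    obtain ⟨ε, hε, hε0⟩ := ((hev.filter_mono nhdsWithin_le_nhds).and
      (self_mem_nhdsWithin : {0}ᶜ ∈ 𝓝[≠] (0 : 𝕜))).exists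
    exact (smul_eq_zero.1 hε).resolve_left hε0
  intro v
  obtain ⟨u, hu⟩ := (π v).2
  exact ⟨u, hu.trans (sub_eq_zero.1 (hker (v - π v) (by rw [map_sub, hπ, sub_self]))).symm⟩

theorem eventually_finrank_range_fderiv_le_of_equivariant [FiniteDimensional 𝕜 E] {f : E → V}
    {ξ : E × E → E} {β : E × V → V} {a : E} (hf : ContDiffAt 𝕜 1 f a)
    (hξ : ContDiffAt 𝕜 1 ξ (a, a)) (hβ : ContDiffAt 𝕜 1 β (a, f a))
    (hξ_left : ∀ᶠ k in 𝓝 a, ξ (a, k) = k) (hξ_right : ∀ᶠ u in 𝓝 a, ξ (u, a) = u)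
    (hfξ : ∀ᶠ q in 𝓝 (a, a), f (ξ q) = β (q.1, f q.2)) :
    ∀ᶠ u in 𝓝 a, Module.finrank 𝕜 (fderiv 𝕜 f u).range ≤
      Module.finrank 𝕜 (fderiv 𝕜 f a).range := by
  have hfa := (hf.differentiableAt (by simp)).hasFDerivAt
  have hξd : ∀ᶠ u in 𝓝 a, DifferentiableAt 𝕜 ξ (u, a) :=
    (Continuous.prodMk_left a).continuousAt.eventually (eventually_differentiableAt hξ)
  have hβd : ∀ᶠ u in 𝓝 a, DifferentiableAt 𝕜 β (u, f a) :=
    (Continuous.prodMk_left (f a)).continuousAt.eventually (eventually_differentiableAt hβ)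
  have hsurj : ∀ᶠ u in 𝓝 a,
      Function.Surjective ((fderiv 𝕜 ξ (u, a)).comp (ContinuousLinearMap.inr 𝕜 E E)) := by
    have hid : (fderiv 𝕜 ξ (a, a)).comp (ContinuousLinearMap.inr 𝕜 E E) = .id 𝕜 E :=
      ((hξ.differentiableAt (by simp)).hasFDerivAt.comp a (hasFDerivAt_prodMk_right a a)).unique
        ((hasFDerivAt_id (𝕜 := 𝕜) a).congr_of_eventuallyEq hξ_left)
    refine eventually_surjective_of_continuousAt (ContinuousAt.clm_comp ?_ continuousAt_const)
      (hid ▸ Function.surjective_id)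
    exact ContinuousAt.comp (f := fun u : E => (u, a)) (hξ.continuousAt_fderiv (by simp))
      (Continuous.prodMk_left a).continuousAt
  filter_upwards [eventually_differentiableAt hf, hξd, hβd, hsurj, hξ_right, hfξ.curry_nhds]
    with u hfu hξu hβu hsu hu hfξu
  have hfu' : HasFDerivAt f (fderiv 𝕜 f u) (ξ (u, a)) := by rw [hu]; exact hfu.hasFDerivAt
  have hchain := (hfu'.comp a (hξu.hasFDerivAt.comp a (hasFDerivAt_prodMk_right u a))).unique
    (((hβu.hasFDerivAt.comp (f a) (hasFDerivAt_prodMk_right u (f a))).comp a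
      hfa).congr_of_eventuallyEq hfξu)
  refine le_trans (Submodule.finrank_mono ?_) (Submodule.finrank_map_le
    ((fderiv 𝕜 β (u, f a)).comp (ContinuousLinearMap.inr 𝕜 E V)).toLinearMap
    (fderiv 𝕜 f a).range)
  rintro _ ⟨w, rfl⟩
  obtain ⟨k, rfl⟩ := hsu w
  exact ⟨_, ⟨k, rfl⟩, (congrArg (· k) hchain).symm⟩

end ConstantRank

section ModelDerivative

variable {𝕜 : Type*} [NontriviallyNormedField 𝕜]
  {E : Type*} [NormedAddCommGroup E] [NormedSpace 𝕜 E] {H : Type*} [TopologicalSpace H]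
  {E' : Type*} [NormedAddCommGroup E'] [NormedSpace 𝕜 E'] {H' : Type*} [TopologicalSpace H']
  {E'' : Type*} [NormedAddCommGroup E''] [NormedSpace 𝕜 E''] {H'' : Type*} [TopologicalSpace H'']
  (I : ModelWithCorners 𝕜 E H) (J : ModelWithCorners 𝕜 E' H') {K : ModelWithCorners 𝕜 E'' H''}
  {M : Type*} [TopologicalSpace M] [ChartedSpace H M]
  {N : Type*} [TopologicalSpace N] [ChartedSpace H' N]
  {P : Type*} [TopologicalSpace P] [ChartedSpace H'' P]

/-- The manifold derivative as a map between the model vector spaces. Every tangent space is by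
definition the model space, but its type mentions the base point; forgetting the base point allows
one to compare derivatives at points which are equal without being syntactically equal. -/
noncomputable def modelDeriv (f : M → N) (x : M) : E →L[𝕜] E' := mfderiv I J f x

/-- `HasMFDerivAt` for a derivative given as a map between the model vector spaces, see
`modelDeriv`. -/
def HasModelDerivAt (f : M → N) (x : M) (f' : E →L[𝕜] E') : Prop := HasMFDerivAt I J f x f'

variable {I J}

namespace HasModelDerivAt

variable {f : M → N} {x : M} {f' f₁' : E →L[𝕜] E'} {g : N → P} {g' : E' →L[𝕜] E''}

theorem of_contMDiffAt {n : WithTop ℕ∞} (hf : ContMDiffAt I J n f x) (hn : n ≠ 0) :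
    HasModelDerivAt I J f x (modelDeriv I J f x) :=
  (hf.mdifferentiableAt hn).hasMFDerivAt

theorem unique (h : HasModelDerivAt I J f x f') (h₁ : HasModelDerivAt I J f x f₁') : f' = f₁' :=
  hasMFDerivAt_unique h h₁

theorem modelDeriv_eq (h : HasModelDerivAt I J f x f') : modelDeriv I J f x = f' :=
  HasMFDerivAt.mfderiv h

theorem congr {f₁ : M → N} (h : HasModelDerivAt I J f x f') (h₁ : f₁ =ᶠ[𝓝 x] f) :
    HasModelDerivAt I J f₁ x f' := HasMFDerivAt.congr_of_eventuallyEq h h₁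

theorem comp {y : N} (hg : HasModelDerivAt J K g y g') (hf : HasModelDerivAt I J f x f')
    (hy : f x = y) : HasModelDerivAt I K (fun z => g (f z)) x (g'.comp f') := by
  subst hy; exact HasMFDerivAt.comp x hg hf

theorem prodMk {h : M → P} {h' : E →L[𝕜] E''} (hf : HasModelDerivAt I J f x f')
    (hh : HasModelDerivAt I K h x h') :
    HasModelDerivAt I (J.prod K) (fun z => (f z, h z)) x (f'.prod h') := HasMFDerivAt.prodMk hf hh

theorem id (x : M) : HasModelDerivAt I I (fun z : M => z) x (ContinuousLinearMap.id 𝕜 E) :=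
  hasMFDerivAt_id x

theorem const (y : N) (x : M) : HasModelDerivAt I J (fun _ : M => y) x 0 :=
  hasMFDerivAt_const y x

end HasModelDerivAt

theorem modelDeriv_eq_fderiv {f : E → E'} : modelDeriv 𝓘(𝕜, E) 𝓘(𝕜, E') f = fderiv 𝕜 f :=
  funext fun _ => mfderiv_eq_fderiv

theorem eventually_surjective_modelDeriv [CompleteSpace 𝕜] [FiniteDimensional 𝕜 E']
    [I.Boundaryless] [IsManifold I 1 M] {g : M → E'} {m : M} (hg : ContMDiffAt I 𝓘(𝕜, E') 1 g m)
    (hs : Function.Surjective (modelDeriv I 𝓘(𝕜, E') g m)) :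
    ∀ᶠ x in 𝓝 m, Function.Surjective (modelDeriv I 𝓘(𝕜, E') g x) := by
  set φ := extChartAt I m
  have hsymm : ContMDiffOn 𝓘(𝕜, E) I 1 φ.symm φ.target := contMDiffOn_extChartAt_symm m
  have hφm : φ.symm (φ m) = m := extChartAt_to_inv m
  have htgt : IsOpen φ.target := isOpen_extChartAt_target m
  have hG : ContMDiffAt 𝓘(𝕜, E) 𝓘(𝕜, E') 1 (fun z => g (φ.symm z)) (φ m) :=
    ContMDiffAt.comp (φ m) (g := g) (by rwa [hφm])
      (hsymm.contMDiffAt (htgt.mem_nhds (mem_extChartAt_target m)))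
  have hGs : ∀ᶠ z in 𝓝 (φ m), Function.Surjective (fderiv 𝕜 (fun z => g (φ.symm z)) z) := by
    refine eventually_surjective_of_continuousAt (hG.contDiffAt.continuousAt_fderiv (by simp)) ?_
    rw [← modelDeriv_eq_fderiv]
    have hcomp := (HasModelDerivAt.of_contMDiffAt hG (by simp)).comp (HasModelDerivAt.of_contMDiffAt
      (contMDiffAt_extChartAt (I := I) (n := 1) (x := m)) (by simp)) rfl
    rw [(hcomp.congr (f₁ := g) (by
      filter_upwards [extChartAt_source_mem_nhds (I := I) m] with z hz
      rw [φ.left_inv hz])).modelDeriv_eq] at hs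
    exact Function.Surjective.of_comp hs
  filter_upwards [(continuousAt_extChartAt (I := I) m).eventually hGs,
    extChartAt_source_mem_nhds (I := I) m,
    (contMDiffAt_iff_contMDiffAt_nhds (by simp)).1 hg] with x hx hxs hgx
  have hcomp := (HasModelDerivAt.of_contMDiffAt hgx (by simp)).comp (HasModelDerivAt.of_contMDiffAt
    (hsymm.contMDiffAt (htgt.mem_nhds (φ.map_source hxs))) (by simp)) (φ.left_inv hxs)
  rw [← modelDeriv_eq_fderiv, hcomp.modelDeriv_eq] at hx
  exact Function.Surjective.of_comp hx

end ModelDerivative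

section Submersion

variable {𝕜 : Type*} [NontriviallyNormedField 𝕜]
  {E : Type v} [NormedAddCommGroup E] [NormedSpace 𝕜 E]
  {E' : Type*} [NormedAddCommGroup E'] [NormedSpace 𝕜 E']
  {M : Type*} [TopologicalSpace M] {N : Type*} [TopologicalSpace N]

section Straightening

variable {F : Type*} [NormedAddCommGroup F] [NormedSpace 𝕜 F]
  (φ : OpenPartialHomeomorph M E) (ψ : OpenPartialHomeomorph N E') (L : E ≃L[𝕜] E' × F) (b : F)

/-- The local homeomorphism `z ↦ (ψ⁻¹ a, c - b)`, where `(a, c) = L (φ z)`. It straightens a map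
which becomes the first projection in the charts `φ` and `ψ` and the splitting `L`. -/
noncomputable def straightening : OpenPartialHomeomorph M (N × F) :=
  (φ ≫ₕ L.toHomeomorph.toOpenPartialHomeomorph) ≫ₕ
    (ψ.symm.prod (Homeomorph.subRight b).toOpenPartialHomeomorph)

variable {φ ψ L}

theorem contMDiffOn_straightening_symm [ChartedSpace E M] [ChartedSpace E' N] {n : WithTop ℕ∞}
    (hφ : φ ∈ IsManifold.maximalAtlas 𝓘(𝕜, E) n M)
    (hψ : ψ ∈ IsManifold.maximalAtlas 𝓘(𝕜, E') n N) :
    ContMDiffOn (𝓘(𝕜, E').prod 𝓘(𝕜, F)) 𝓘(𝕜, E) n (straightening φ ψ L b).symm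
      (straightening φ ψ L b).target := by
  have hψfst : ContMDiffOn (𝓘(𝕜, E').prod 𝓘(𝕜, F)) 𝓘(𝕜, E') n (fun q : N × F => ψ q.1)
      (straightening φ ψ L b).target :=
    (contMDiffOn_of_mem_maximalAtlas hψ).comp contMDiff_fst.contMDiffOn fun q hq => hq.1.1
  have hsnd : ContMDiffOn (𝓘(𝕜, E').prod 𝓘(𝕜, F)) 𝓘(𝕜, F) n (fun q : N × F => q.2 + b)
      (straightening φ ψ L b).target :=
    (contDiff_id.add contDiff_const).contMDiff.comp_contMDiffOn contMDiff_snd.contMDiffOn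
  exact (contMDiffOn_symm_of_mem_maximalAtlas hφ).comp
    (L.symm.contDiff.contMDiff.comp_contMDiffOn (hψfst.prodMk_space hsnd)) fun q hq => by
      simpa using hq.2.2

variable {f : M → N} (hfs : MapsTo f φ.source ψ.source)
  (hfL : ∀ z ∈ φ.source, (L (φ z)).1 = ψ (f z))

include hfs hfL

theorem straightening_source : (straightening φ ψ L b).source = φ.source := by
  ext z
  simp only [straightening, OpenPartialHomeomorph.trans_source, mem_inter_iff, mem_preimage,
    OpenPartialHomeomorph.prod_source, mem_prod]
  refine ⟨fun hz => hz.1.1, fun hz => ⟨⟨hz, trivial⟩, ?_, trivial⟩⟩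
  change (L (φ z)).1 ∈ ψ.target
  rw [hfL z hz]
  exact ψ.map_source (hfs hz)

theorem straightening_apply {z : M} (hz : z ∈ φ.source) :
    straightening φ ψ L b z = (f z, (L (φ z)).2 - b) := by
  change (ψ.symm (L (φ z)).1, (L (φ z)).2 - b) = _
  rw [hfL z hz, ψ.left_inv (hfs hz)]

theorem contMDiffOn_straightening [ChartedSpace E M] [ChartedSpace E' N] {n : WithTop ℕ∞}
    (hφ : φ ∈ IsManifold.maximalAtlas 𝓘(𝕜, E) n M)
    (hψ : ψ ∈ IsManifold.maximalAtlas 𝓘(𝕜, E') n N) :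
    ContMDiffOn 𝓘(𝕜, E) (𝓘(𝕜, E').prod 𝓘(𝕜, F)) n (straightening φ ψ L b) φ.source := by
  have hLφ : ContMDiffOn 𝓘(𝕜, E) 𝓘(𝕜, E' × F) n (fun z => L (φ z)) φ.source :=
    L.contDiff.contMDiff.comp_contMDiffOn (contMDiffOn_of_mem_maximalAtlas hφ)
  refine ContMDiffOn.prodMk (f := fun z => ψ.symm (L (φ z)).1) (g := fun z => (L (φ z)).2 - b)
    ((contMDiffOn_symm_of_mem_maximalAtlas hψ).comp
      (contDiff_fst.contMDiff.comp_contMDiffOn hLφ) fun z hz => ?_)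
    ((contDiff_snd.sub contDiff_const).contMDiff.comp_contMDiffOn hLφ)
  change (L (φ z)).1 ∈ ψ.target
  rw [hfL z hz]
  exact ψ.map_source (hfs hz)

end Straightening

variable {H : Type*} [TopologicalSpace H] {H' : Type*} [TopologicalSpace H']

/-- A product decomposition of `M` near `x` in which `f` is the first projection and `x` is the
point `(f x, 0)`. -/
structure SubmersionChart (I : ModelWithCorners 𝕜 E H) (J : ModelWithCorners 𝕜 E' H')
    [ChartedSpace H M] [ChartedSpace H' N] (f : M → N) (x : M) where
  F : Type v
  [normed : NormedAddCommGroup F]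
  [space : NormedSpace 𝕜 F]
  e : OpenPartialHomeomorph M (N × F)
  mem_source : x ∈ e.source
  contMDiffOn : ContMDiffOn I (J.prod 𝓘(𝕜, F)) ∞ e e.source
  contMDiffOn_symm : ContMDiffOn (J.prod 𝓘(𝕜, F)) I ∞ e.symm e.target
  fst_eq : ∀ z ∈ e.source, (e z).1 = f z
  snd_base : (e x).2 = 0

attribute [instance] SubmersionChart.normed SubmersionChart.space

theorem nonempty_submersionChart [ChartedSpace E M] [ChartedSpace E' N] {f : M → N}
    (hf : Manifold.IsSubmersion 𝓘(𝕜, E) 𝓘(𝕜, E') ∞ f) (x : M) :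
    Nonempty (SubmersionChart 𝓘(𝕜, E) 𝓘(𝕜, E') f x) := by
  obtain ⟨F, _, _, h⟩ := hf.isSubmersionAt x
  have hfs : MapsTo f h.domChart.source h.codChart.source := h.source_subset_preimage_source
  have hfL : ∀ z ∈ h.domChart.source, (h.equiv (h.domChart z)).1 = h.codChart (f z) := by
    intro z hz
    have hmem : h.domChart z ∈ (h.domChart.extend 𝓘(𝕜, E)).target := by
      simpa using h.domChart.map_source hz
    simpa [h.domChart.left_inv hz] using (h.writtenInCharts hmem).symm
  set b := (h.equiv (h.domChart x)).2
  have hsrc := straightening_source b hfs hfL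
  have hx := h.mem_domChart_source
  refine ⟨⟨F, straightening h.domChart h.codChart h.equiv b, hsrc ▸ hx, ?_,
    contMDiffOn_straightening_symm b h.domChart_mem_maximalAtlas h.codChart_mem_maximalAtlas,
    fun z hz => ?_, ?_⟩⟩
  · rw [hsrc]
    exact contMDiffOn_straightening b hfs hfL h.domChart_mem_maximalAtlas
      h.codChart_mem_maximalAtlas
  · rw [straightening_apply b hfs hfL (hsrc ▸ hz)]
  · rw [straightening_apply b hfs hfL hx, sub_self]

namespace SubmersionChart

variable {I : ModelWithCorners 𝕜 E H} {J : ModelWithCorners 𝕜 E' H'} [ChartedSpace H M]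
  [ChartedSpace H' N] {f : M → N} {x : M} (c : SubmersionChart I J f x)

/-- The fibre coordinate of a submersion chart. -/
def coord (z : M) : c.F := (c.e z).2

/-- The parametrization of the fibre of `f` through `x`, with `fib 0 = x`. -/
noncomputable def fib (b : c.F) : M := c.e.symm (f x, b)

/-- The local section of `f` through `x` along which the fibre coordinate vanishes. -/
noncomputable def sec (n : N) : M := c.e.symm (n, 0)

theorem e_eq {z : M} (hz : z ∈ c.e.source) : c.e z = (f z, c.coord z) :=
  Prod.ext (c.fst_eq z hz) rfl

theorem coord_base : c.coord x = 0 := c.snd_base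

theorem e_base : c.e x = (f x, 0) := by rw [c.e_eq c.mem_source, c.coord_base]

theorem symm_base : c.e.symm (f x, 0) = x := by
  rw [← c.e_base, c.e.left_inv c.mem_source]

theorem fib_zero : c.fib 0 = x := c.symm_base

theorem sec_base : c.sec (f x) = x := c.symm_base

theorem f_symm {q : N × c.F} (hq : q ∈ c.e.target) : f (c.e.symm q) = q.1 := by
  rw [← c.fst_eq _ (c.e.map_target hq), c.e.right_inv hq]

theorem coord_symm {q : N × c.F} (hq : q ∈ c.e.target) : c.coord (c.e.symm q) = q.2 := by
  rw [coord, c.e.right_inv hq]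

theorem symm_eq {z : M} (hz : z ∈ c.e.source) : c.e.symm (f z, c.coord z) = z := by
  rw [← c.e_eq hz, c.e.left_inv hz]

theorem source_mem_nhds : c.e.source ∈ 𝓝 x := c.e.open_source.mem_nhds c.mem_source

theorem target_mem_nhds : c.e.target ∈ 𝓝 (f x, (0 : c.F)) :=
  c.e.open_target.mem_nhds (c.e_base ▸ c.e.map_source c.mem_source)

theorem fib_coord {z : M} (hz : z ∈ c.e.source) (hfz : f z = f x) : c.fib (c.coord z) = z := by
  rw [fib, ← hfz, c.symm_eq hz]

theorem eventually_fib_mem : ∀ᶠ b in 𝓝 0, (f x, b) ∈ c.e.target :=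
  (Continuous.prodMk_right (f x)).continuousAt.eventually_mem c.target_mem_nhds

theorem eventually_f_sec : ∀ᶠ n in 𝓝 (f x), f (c.sec n) = n :=
  ((Continuous.prodMk_left (0 : c.F)).continuousAt.eventually_mem c.target_mem_nhds).mono
    fun _ hn => c.f_symm hn

theorem eventually_f_fib : ∀ᶠ b in 𝓝 0, f (c.fib b) = f x :=
  c.eventually_fib_mem.mono fun _ hb => c.f_symm hb

theorem eventually_coord_fib : ∀ᶠ b in 𝓝 0, c.coord (c.fib b) = b :=
  c.eventually_fib_mem.mono fun _ hb => c.coord_symm hb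

include c in
theorem contMDiffAt : ContMDiffAt I J ∞ f x :=
  (contMDiffAt_fst.comp x (c.contMDiffOn.contMDiffAt c.source_mem_nhds)).congr_of_eventuallyEq
    (mem_of_superset c.source_mem_nhds fun z hz => (c.fst_eq z hz).symm)

theorem contMDiffAt_coord : ContMDiffAt I 𝓘(𝕜, c.F) ∞ c.coord x :=
  contMDiffAt_snd.comp x (c.contMDiffOn.contMDiffAt c.source_mem_nhds)

theorem contMDiffAt_symm : ContMDiffAt (J.prod 𝓘(𝕜, c.F)) I ∞ c.e.symm (f x, 0) :=
  c.contMDiffOn_symm.contMDiffAt c.target_mem_nhds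

theorem contMDiffAt_fib : ContMDiffAt 𝓘(𝕜, c.F) I ∞ c.fib 0 :=
  c.contMDiffAt_symm.comp (f := fun b : c.F => (f x, b)) 0 (contMDiffAt_const.prodMk contMDiffAt_id)

theorem eventually_contMDiffAt_sec : ∀ᶠ n in 𝓝 (f x), ContMDiffAt J I ∞ c.sec n :=
  ((Continuous.prodMk_left (0 : c.F)).continuousAt.eventually_mem c.target_mem_nhds).mono
    fun n hn => (c.contMDiffOn_symm.contMDiffAt (c.e.open_target.mem_nhds hn)).comp
        (f := fun n : N => (n, (0 : c.F))) n (contMDiffAt_id.prodMk contMDiffAt_const)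

theorem contMDiffAt_sec : ContMDiffAt J I ∞ c.sec (f x) := c.eventually_contMDiffAt_sec.self_of_nhds

theorem tendsto_fib : Tendsto c.fib (𝓝 0) (𝓝 x) := by
  simpa only [ContinuousAt, c.fib_zero] using c.contMDiffAt_fib.continuousAt

theorem tendsto_sec : Tendsto c.sec (𝓝 (f x)) (𝓝 x) := by
  simpa only [ContinuousAt, c.sec_base] using c.contMDiffAt_sec.continuousAt

/-- The differential at `f x` of the section `sec`. -/
noncomputable def dSec : E' →L[𝕜] E := modelDeriv J I c.sec (f x)

/-- The differential at `0` of the parametrization `fib` of the fibre. -/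
noncomputable def dFib : c.F →L[𝕜] E := modelDeriv 𝓘(𝕜, c.F) I c.fib 0

/-- The differential at `x` of the fibre coordinate. -/
noncomputable def dCoord : E →L[𝕜] c.F := modelDeriv I 𝓘(𝕜, c.F) c.coord x

include c in
theorem hasModelDerivAt : HasModelDerivAt I J f x (modelDeriv I J f x) :=
  .of_contMDiffAt c.contMDiffAt (by simp)

theorem hasModelDerivAt_sec : HasModelDerivAt J I c.sec (f x) c.dSec :=
  .of_contMDiffAt c.contMDiffAt_sec (by simp)

theorem hasModelDerivAt_fib : HasModelDerivAt 𝓘(𝕜, c.F) I c.fib 0 c.dFib :=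
  .of_contMDiffAt c.contMDiffAt_fib (by simp)

theorem hasModelDerivAt_coord : HasModelDerivAt I 𝓘(𝕜, c.F) c.coord x c.dCoord :=
  .of_contMDiffAt c.contMDiffAt_coord (by simp)

theorem dSec_add_dFib (v : E) : c.dSec (modelDeriv I J f x v) + c.dFib (c.dCoord v) = v := by
  have hsymm : HasModelDerivAt (J.prod 𝓘(𝕜, c.F)) I c.e.symm (f x, 0) _ :=
    .of_contMDiffAt c.contMDiffAt_symm (by simp)
  have hid := (hsymm.comp (c.hasModelDerivAt.prodMk c.hasModelDerivAt_coord)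
    (by rw [c.coord_base])).unique ((HasModelDerivAt.id x).congr
      (mem_of_superset c.source_mem_nhds fun z hz => c.symm_eq hz))
  rw [c.hasModelDerivAt_sec.unique (hsymm.comp ((HasModelDerivAt.id (f x)).prodMk
      (HasModelDerivAt.const (0 : c.F) (f x))) rfl),
    c.hasModelDerivAt_fib.unique (hsymm.comp ((HasModelDerivAt.const (f x) (0 : c.F)).prodMk
      (HasModelDerivAt.id (0 : c.F))) rfl),
    ContinuousLinearMap.comp_apply, ContinuousLinearMap.comp_apply, ← map_add]
  simpa using congrArg (· v) hid

theorem modelDeriv_dSec (v : E') : modelDeriv I J f x (c.dSec v) = v :=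
  congrArg (· v) ((c.hasModelDerivAt.comp c.hasModelDerivAt_sec c.sec_base).unique
    ((HasModelDerivAt.id (f x)).congr c.eventually_f_sec))

theorem modelDeriv_dFib (b : c.F) : modelDeriv I J f x (c.dFib b) = 0 :=
  congrArg (· b) ((c.hasModelDerivAt.comp c.hasModelDerivAt_fib c.fib_zero).unique
    ((HasModelDerivAt.const (f x) (0 : c.F)).congr c.eventually_f_fib))

theorem dCoord_dFib (b : c.F) : c.dCoord (c.dFib b) = b :=
  congrArg (· b) ((c.hasModelDerivAt_coord.comp c.hasModelDerivAt_fib c.fib_zero).unique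
    ((HasModelDerivAt.id 0).congr c.eventually_coord_fib))

theorem dFib_dCoord {v : E} (hv : modelDeriv I J f x v = 0) : c.dFib (c.dCoord v) = v := by
  simpa [hv] using c.dSec_add_dFib v

instance [FiniteDimensional 𝕜 E] : FiniteDimensional 𝕜 c.F :=
  Module.Finite.of_surjective c.dCoord.toLinearMap fun b => ⟨_, c.dCoord_dFib b⟩

end SubmersionChart

variable [ChartedSpace E M] [ChartedSpace E' N] {f : M → N}

theorem surjective_modelDeriv_of_isSubmersion
    (hf : Manifold.IsSubmersion 𝓘(𝕜, E) 𝓘(𝕜, E') ∞ f) (x : M) :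
    Function.Surjective (modelDeriv 𝓘(𝕜, E) 𝓘(𝕜, E') f x) := by
  obtain ⟨c⟩ := nonempty_submersionChart hf x
  exact fun v => ⟨_, c.modelDeriv_dSec v⟩

theorem isOpenMap_of_isSubmersion (hf : Manifold.IsSubmersion 𝓘(𝕜, E) 𝓘(𝕜, E') ∞ f) :
    IsOpenMap f := by
  rw [isOpenMap_iff_nhds_le]
  intro x
  obtain ⟨c⟩ := nonempty_submersionChart hf x
  calc 𝓝 (f x) = map (fun n => f (c.sec n)) (𝓝 (f x)) := by
        rw [map_congr c.eventually_f_sec, Filter.map_id']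
    _ = map f (map c.sec (𝓝 (f x))) := rfl
    _ ≤ map f (𝓝 x) := map_mono c.tendsto_sec

end Submersion

namespace Mfd

variable {𝕜 : Type v} [RCLike 𝕜] {M : Mfd.{v, w} 𝕜} {N : Mfd.{v, u} 𝕜}

theorem isEmbeddedSubmanifold_iff_eventually {S : Set M} : M.IsEmbeddedSubmanifold S ↔
    ∀ m ∈ S, ∃ (k : ℕ) (h : M → EuclideanSpace 𝕜 (Fin k)),
      (∀ᶠ x in 𝓝 m, ContMDiffAt M.I 𝓘(𝕜, EuclideanSpace 𝕜 (Fin k)) ∞ h x) ∧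
      Function.Surjective (modelDeriv M.I 𝓘(𝕜, EuclideanSpace 𝕜 (Fin k)) h m) ∧
      ∀ᶠ x in 𝓝 m, (x ∈ S ↔ h x = 0) := by
  refine forall₂_congr fun m _ => ⟨?_, ?_⟩
  · rintro ⟨U, hU, hmU, k, h, hh, hhs, hSU⟩
    refine ⟨k, h, ?_, hhs m hmU, ?_⟩ <;> filter_upwards [hU.mem_nhds hmU] with x hx
    · exact hh.contMDiffAt (hU.mem_nhds hx)
    · simpa [hx] using Set.ext_iff.1 hSU x
  · rintro ⟨k, h, hh, hhs, hS⟩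
    have := IsManifold.of_le (I := M.I) (M := M) (m := 1) (n := ∞) (by simp)
    obtain ⟨U, hUh, hU, hmU⟩ := eventually_nhds_iff.1 (hh.and ((eventually_surjective_modelDeriv
      (hh.self_of_nhds.of_le (by simp)) hhs).and hS))
    exact ⟨U, hU, hmU, k, h, fun x hx => (hUh x hx).1.contMDiffWithinAt,
      fun x hx => (hUh x hx).2.1, Set.ext fun x =>
        ⟨fun hx => ⟨hx.2, (hUh x hx.2).2.2.1 hx.1⟩, fun hx => ⟨(hUh x hx.1).2.2.2 hx.2, hx.1⟩⟩⟩

variable {f : M → N}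

theorem IsEmbeddedSubmanifold.preimage (hf : Manifold.IsSubmersion M.I N.I ∞ f) {S : Set N}
    (hS : N.IsEmbeddedSubmanifold S) : M.IsEmbeddedSubmanifold (f ⁻¹' S) := by
  rw [isEmbeddedSubmanifold_iff_eventually] at hS ⊢
  intro x hx
  obtain ⟨k, h, hh, hhs, hSh⟩ := hS (f x) hx
  have hfx : Tendsto f (𝓝 x) (𝓝 (f x)) := hf.contMDiff.continuous.continuousAt
  refine ⟨k, h ∘ f, (hfx.eventually hh).mono fun z hz => hz.comp z hf.contMDiff.contMDiffAt, ?_,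
    hfx.eventually hSh⟩
  have hcomp := (HasModelDerivAt.of_contMDiffAt hh.self_of_nhds (by simp)).comp
    (HasModelDerivAt.of_contMDiffAt (hf.contMDiff.contMDiffAt (x := x)) (by simp)) rfl
  exact hcomp.modelDeriv_eq ▸ hhs.comp (surjective_modelDeriv_of_isSubmersion hf x)

theorem surjective_modelDeriv_comp_sec {k : ℕ} {h : M → EuclideanSpace 𝕜 (Fin k)} {x : M}
    (c : SubmersionChart M.I N.I f x)
    (hh : ContMDiffAt M.I 𝓘(𝕜, EuclideanSpace 𝕜 (Fin k)) ∞ h x)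
    (hhs : Function.Surjective (modelDeriv M.I 𝓘(𝕜, EuclideanSpace 𝕜 (Fin k)) h x))
    (hfib : ∀ᶠ b in 𝓝 0, h (c.fib b) = 0) :
    Function.Surjective
      (modelDeriv N.I 𝓘(𝕜, EuclideanSpace 𝕜 (Fin k)) (fun n => h (c.sec n)) (f x)) := by
  have hhx := HasModelDerivAt.of_contMDiffAt hh (by simp)
  have hdFib : (modelDeriv M.I 𝓘(𝕜, EuclideanSpace 𝕜 (Fin k)) h x).comp c.dFib = 0 :=
    (hhx.comp c.hasModelDerivAt_fib c.fib_zero).unique ((HasModelDerivAt.const 0 0).congr hfib)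
  rw [(hhx.comp c.hasModelDerivAt_sec c.sec_base).modelDeriv_eq]
  intro a
  obtain ⟨v, rfl⟩ := hhs a
  refine ⟨modelDeriv M.I N.I f x v, ?_⟩
  conv_rhs => rw [← c.dSec_add_dFib v, map_add]
  rw [show modelDeriv M.I 𝓘(𝕜, EuclideanSpace 𝕜 (Fin k)) h x (c.dFib (c.dCoord v)) = 0 from
    congrArg (· (c.dCoord v)) hdFib, add_zero, ContinuousLinearMap.comp_apply]

theorem IsEmbeddedSubmanifold.of_preimage (hf : Manifold.IsSubmersion M.I N.I ∞ f)
    (hfs : Function.Surjective f) {S : Set N} (hS : M.IsEmbeddedSubmanifold (f ⁻¹' S)) :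
    N.IsEmbeddedSubmanifold S := by
  rw [isEmbeddedSubmanifold_iff_eventually] at hS ⊢
  intro n hn
  obtain ⟨x, rfl⟩ := hfs n
  obtain ⟨k, h, hh, hhs, hSh⟩ := hS x hn
  obtain ⟨c⟩ := nonempty_submersionChart hf x
  refine ⟨k, fun n => h (c.sec n), ?_,
    surjective_modelDeriv_comp_sec c hh.self_of_nhds hhs ?_, ?_⟩
  · filter_upwards [c.eventually_contMDiffAt_sec, c.tendsto_sec.eventually hh] with n hn hhn
    exact hhn.comp n hn
  · filter_upwards [c.eventually_f_fib, c.tendsto_fib.eventually hSh] with b hfb hSb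
    exact hSb.1 (by rwa [mem_preimage, hfb])
  · filter_upwards [c.eventually_f_sec, c.tendsto_sec.eventually hSh] with n hfn hSn
    rw [← hSn, mem_preimage, hfn]

theorem isEmbeddedSubmanifold_preimage_iff (hf : Manifold.IsSubmersion M.I N.I ∞ f)
    (hfs : Function.Surjective f) {S : Set N} :
    M.IsEmbeddedSubmanifold (f ⁻¹' S) ↔ N.IsEmbeddedSubmanifold S :=
  ⟨.of_preimage hf hfs, .preimage hf⟩

theorem mem_tangentOfSubset_of_hasModelDerivAt {S : Set M} {m : M} {c : 𝕜 → M} (h₀ : c 0 = m)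
    (hc : ContMDiffAt 𝓘(𝕜, 𝕜) M.I ∞ c 0) (hS : ∀ᶠ ε in 𝓝 0, c ε ∈ S) {c' : 𝕜 →L[𝕜] M.E}
    (hc' : HasModelDerivAt 𝓘(𝕜, 𝕜) M.I c 0 c') : c' 1 ∈ M.tangentOfSubset S m :=
  Submodule.subset_span ⟨c, h₀, hc, hS, congrArg (· 1) hc'.modelDeriv_eq⟩

theorem tangentOfSubset_le {S : Set M} {m : M} {T : Submodule 𝕜 M.E}
    (h : ∀ (c : 𝕜 → M) (c' : 𝕜 →L[𝕜] M.E), c 0 = m → ContMDiffAt 𝓘(𝕜, 𝕜) M.I ∞ c 0 →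
      (∀ᶠ ε in 𝓝 0, c ε ∈ S) → HasModelDerivAt 𝓘(𝕜, 𝕜) M.I c 0 c' → c' 1 ∈ T) :
    M.tangentOfSubset S m ≤ T := by
  refine Submodule.span_le.2 ?_
  rintro e ⟨c, h₀, hc, hS, rfl⟩
  exact h c _ h₀ hc hS (.of_contMDiffAt hc (by simp))

theorem map_modelDeriv_tangentOfSubset_le {S : Set M} {T : Set N} {m : M}
    (hf : ContMDiffAt M.I N.I ∞ f m) (hST : ∀ᶠ x in 𝓝 m, x ∈ S → f x ∈ T) :
    Submodule.map (modelDeriv M.I N.I f m).toLinearMap (M.tangentOfSubset S m) ≤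
      N.tangentOfSubset T (f m) := by
  rw [Submodule.map_le_iff_le_comap]
  refine tangentOfSubset_le fun c c' h₀ hc hS hc' => ?_
  have hcm : Tendsto c (𝓝 0) (𝓝 m) := h₀ ▸ hc.continuousAt
  refine mem_tangentOfSubset_of_hasModelDerivAt (c := fun ε => f (c ε)) (by rw [h₀])
    (ContMDiffAt.comp_of_eq hf hc h₀) ?_
    ((HasModelDerivAt.of_contMDiffAt hf (by simp)).comp hc' h₀)
  filter_upwards [hS, hcm.eventually hST] with ε hε hcε using hcε hε

theorem dFib_mem_tangentOfSubset {S : Set N} {x : M} (c : SubmersionChart M.I N.I f x)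
    (hx : f x ∈ S) (b : c.F) : c.dFib b ∈ M.tangentOfSubset (f ⁻¹' S) x := by
  have hline : ContDiff 𝕜 ∞ fun ε : 𝕜 => ε • b := by fun_prop
  have hline₀ : (0 : 𝕜) • b = 0 := zero_smul _ _
  have hderiv : HasModelDerivAt 𝓘(𝕜, 𝕜) 𝓘(𝕜, c.F) (fun ε : 𝕜 => ε • b) 0
      ((ContinuousLinearMap.id 𝕜 𝕜).smulRight b) :=
    ((ContinuousLinearMap.id 𝕜 𝕜).smulRight b).hasFDerivAt.hasMFDerivAt
  have hf : ∀ᶠ ε in 𝓝 (0 : 𝕜), f (c.fib (ε • b)) = f x :=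
    (hline.continuous.tendsto' 0 0 hline₀).eventually c.eventually_f_fib
  simpa using mem_tangentOfSubset_of_hasModelDerivAt (S := f ⁻¹' S)
    (c := fun ε : 𝕜 => c.fib (ε • b)) (by rw [hline₀, c.fib_zero])
    (ContMDiffAt.comp_of_eq (g := c.fib) (f := fun ε : 𝕜 => ε • b) c.contMDiffAt_fib
      hline.contMDiff.contMDiffAt hline₀)
    (hf.mono fun ε hε => by rwa [mem_preimage, hε]) (c.hasModelDerivAt_fib.comp hderiv hline₀)

theorem comap_modelDeriv_tangentOfSubset (hf : Manifold.IsSubmersion M.I N.I ∞ f) {S : Set N}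
    {x : M} (hx : f x ∈ S) :
    Submodule.comap (modelDeriv M.I N.I f x).toLinearMap (N.tangentOfSubset S (f x)) =
      M.tangentOfSubset (f ⁻¹' S) x := by
  obtain ⟨c⟩ := nonempty_submersionChart hf x
  refine le_antisymm (fun v hv => ?_) (Submodule.map_le_iff_le_comap.1
    (map_modelDeriv_tangentOfSubset_le c.contMDiffAt (.of_forall fun _ hz => hz)))
  have hsec := map_modelDeriv_tangentOfSubset_le (S := S) (T := f ⁻¹' S) c.contMDiffAt_sec
    (c.eventually_f_sec.mono fun n hn hnS => by rwa [mem_preimage, hn])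
  rw [c.sec_base] at hsec
  rw [← c.dSec_add_dFib v]
  exact add_mem (hsec ⟨_, hv, rfl⟩) (dFib_mem_tangentOfSubset c hx _)

end Mfd

namespace LieGroupoid

variable {𝕜 : Type v} [RCLike 𝕜] (Γ : LieGroupoid.{v, u} 𝕜)

theorem eq_inv_of_mul_eq_unit {g h : Γ.Arr} (hgh : Γ.tgt g = Γ.src h)
    (hm : Γ.mul g h = Γ.unit (Γ.src g)) : h = Γ.inv g := by
  calc h = Γ.mul (Γ.unit (Γ.src h)) h := (Γ.unit_mul h).symm
    _ = Γ.mul (Γ.mul (Γ.inv g) g) h := by rw [Γ.inv_mul, hgh]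
    _ = Γ.mul (Γ.inv g) (Γ.unit (Γ.src g)) := by rw [Γ.mul_assoc _ _ _ (Γ.tgt_inv g) hgh, hm]
    _ = Γ.inv g := by rw [← Γ.tgt_inv g, Γ.mul_unit]

theorem inv_unit (m : Γ.Obj) : Γ.inv (Γ.unit m) = Γ.unit m := by
  have h : Γ.mul (Γ.unit m) (Γ.unit m) = Γ.unit m := by
    simpa only [Γ.tgt_unit] using Γ.mul_unit (Γ.unit m)
  exact (Γ.eq_inv_of_mul_eq_unit (by rw [Γ.tgt_unit, Γ.src_unit]) (by rw [h, Γ.src_unit])).symm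

theorem inv_inv (g : Γ.Arr) : Γ.inv (Γ.inv g) = g :=
  (Γ.eq_inv_of_mul_eq_unit (Γ.tgt_inv g) (by rw [Γ.inv_mul, Γ.src_inv])).symm

theorem inv_mul_cancel_left {g h : Γ.Arr} (hgh : Γ.tgt g = Γ.src h) :
    Γ.mul (Γ.inv g) (Γ.mul g h) = h := by
  rw [← Γ.mul_assoc _ _ _ (Γ.tgt_inv g) hgh, Γ.inv_mul, hgh, Γ.unit_mul]

theorem mul_inv_cancel_left {g h : Γ.Arr} (hgh : Γ.src g = Γ.src h) :
    Γ.mul g (Γ.mul (Γ.inv g) h) = h := by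
  rw [← Γ.mul_assoc _ _ _ (Γ.src_inv g).symm (by rw [Γ.tgt_inv, hgh]), Γ.mul_inv, hgh, Γ.unit_mul]

theorem inv_mul_rev {g h : Γ.Arr} (hgh : Γ.tgt g = Γ.src h) :
    Γ.inv (Γ.mul g h) = Γ.mul (Γ.inv h) (Γ.inv g) := by
  have hinv : Γ.tgt (Γ.inv h) = Γ.src (Γ.inv g) := by rw [Γ.tgt_inv, Γ.src_inv, hgh]
  have hsrc : Γ.tgt h = Γ.src (Γ.mul (Γ.inv h) (Γ.inv g)) := by rw [Γ.src_mul _ _ hinv, Γ.src_inv]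
  refine (Γ.eq_inv_of_mul_eq_unit (by rw [Γ.tgt_mul _ _ hgh, hsrc]) ?_).symm
  rw [Γ.mul_assoc _ _ _ hgh hsrc, Γ.mul_inv_cancel_left (by rw [Γ.src_inv, hgh]), Γ.mul_inv,
    Γ.src_mul _ _ hgh]

theorem continuous_src : Continuous Γ.src := Γ.submersion_src.contMDiff.continuous

theorem continuous_tgt : Continuous Γ.tgt := Γ.submersion_tgt.contMDiff.continuous

theorem continuous_inv : Continuous Γ.inv := Γ.smooth_inv.continuous

theorem IsStable.closure {S : Set Γ.Obj} (hS : Γ.IsStable S) : Γ.IsStable (closure S) := by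
  have hpre : Γ.tgt ⁻¹' S = Γ.src ⁻¹' S := Set.ext hS
  refine Set.ext_iff.1 (?_ : Γ.tgt ⁻¹' _root_.closure S = Γ.src ⁻¹' _root_.closure S)
  rw [(isOpenMap_of_isSubmersion Γ.submersion_tgt).preimage_closure_eq_closure_preimage
      Γ.continuous_tgt, hpre,
    (isOpenMap_of_isSubmersion Γ.submersion_src).preimage_closure_eq_closure_preimage
      Γ.continuous_src]

/-- The homeomorphism `(g, x) ↦ (x, g⁻¹)` between the domain of a left action and the domain of a
right action with moment map `p`. -/
def actionDomainHomeomorph {X : Type*} [TopologicalSpace X] (p : X → Γ.Obj) :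
    {q : Γ.Arr × X // Γ.tgt q.1 = p q.2} ≃ₜ {q : X × Γ.Arr // p q.1 = Γ.src q.2} where
  toFun q := ⟨(q.1.2, Γ.inv q.1.1), by rw [Γ.src_inv, q.2]⟩
  invFun q := ⟨(Γ.inv q.1.2, q.1.1), by rw [Γ.tgt_inv, q.2]⟩
  left_inv q := Subtype.ext (Prod.ext (Γ.inv_inv _) rfl)
  right_inv q := Subtype.ext (Prod.ext rfl (Γ.inv_inv _))
  continuous_toFun := by have := Γ.continuous_inv; fun_prop
  continuous_invFun := by have := Γ.continuous_inv; fun_prop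

end LieGroupoid

/-- The right action `x · g = g⁻¹ · x`. -/
def LeftModule.toRightModule {𝕜 : Type v} [RCLike 𝕜] {Γ : LieGroupoid.{v, u} 𝕜} {X : Mfd.{v, w} 𝕜}
    {p : X → Γ.Obj} (A : LeftModule Γ X p) : RightModule Γ X p where
  act x g := A.act (Γ.inv g) x
  moment_act x g h := by rw [A.moment_act _ _ (by rw [Γ.tgt_inv, h]), Γ.src_inv]
  act_unit x := by rw [Γ.inv_unit, A.unit_act]
  act_mul x g h hx hgh := by
    rw [Γ.inv_mul_rev hgh, A.mul_act _ _ _ (by rw [Γ.tgt_inv, Γ.src_inv, hgh])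
      (by rw [Γ.tgt_inv, hx])]
  smooth_act := A.smooth_act.comp
    ((Γ.smooth_inv.comp contMDiff_snd).prodMk contMDiff_fst).contMDiffOn
    fun q hq => (Γ.tgt_inv q.2).trans (Eq.symm hq)

/-- The left action `g · x = x · g⁻¹`. -/
def RightModule.toLeftModule {𝕜 : Type v} [RCLike 𝕜] {Γ : LieGroupoid.{v, u} 𝕜} {X : Mfd.{v, w} 𝕜}
    {p : X → Γ.Obj} (A : RightModule Γ X p) : LeftModule Γ X p where
  act g x := A.act x (Γ.inv g)
  moment_act g x h := by rw [A.moment_act _ _ (by rw [Γ.src_inv, h]), Γ.tgt_inv]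
  unit_act x := by rw [Γ.inv_unit, A.act_unit]
  mul_act g h x hgh hx := by
    rw [Γ.inv_mul_rev hgh, A.act_mul _ _ _ (by rw [Γ.src_inv, hx])
      (by rw [Γ.tgt_inv, Γ.src_inv, hgh])]
  smooth_act := A.smooth_act.comp
    (contMDiff_snd.prodMk (Γ.smooth_inv.comp contMDiff_fst)).contMDiffOn
    fun q hq => (Eq.symm hq).trans (Γ.src_inv q.1).symm

namespace LieMoritaEquivalence

variable {𝕜 : Type v} [RCLike 𝕜] {Γ Γ' : LieGroupoid.{v, u} 𝕜}
  (Φ : LieMoritaEquivalence.{v, u, w} Γ Γ')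

theorem isOpenQuotientMap_p : IsOpenQuotientMap Φ.p :=
  ⟨Φ.surjective_p, Φ.submersion_p.contMDiff.continuous, isOpenMap_of_isSubmersion Φ.submersion_p⟩

/-- The inverse Morita equivalence: the same space `X`, with the two actions exchanged by means of
the inverse maps of the groupoids. -/
def symm : LieMoritaEquivalence.{v, u, w} Γ' Γ where
  X := Φ.X
  p := Φ.p'
  p' := Φ.p
  submersion_p := Φ.submersion_p'
  submersion_p' := Φ.submersion_p
  surjective_p := Φ.surjective_p'
  surjective_p' := Φ.surjective_p
  left := Φ.right.toLeftModule
  right := Φ.left.toRightModule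
  p'_left g x h := Φ.p_right _ _ (by rw [Γ'.src_inv, h])
  p_right x g h := Φ.p'_left _ _ (by rw [Γ.tgt_inv, h])
  comm g x g' h h' := (Φ.comm _ _ _ (by rw [Γ.tgt_inv, h']) (by rw [Γ'.src_inv, h])).symm
  proper_left := ((Homeomorph.prodComm Φ.X Φ.X).isProperMap.comp Φ.proper_right).comp
    (Γ'.actionDomainHomeomorph Φ.p').isProperMap
  proper_right := ((Homeomorph.prodComm Φ.X Φ.X).isProperMap.comp Φ.proper_left).comp
    (Γ.actionDomainHomeomorph Φ.p).symm.isProperMap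
  free_left g x h hx := by
    rw [← Γ'.inv_inv g, Φ.free_right x _ (by rw [Γ'.src_inv, h]) hx, Γ'.inv_unit]
  free_right x g h hx := by
    rw [← Γ.inv_inv g, Φ.free_left _ x (by rw [Γ.tgt_inv, h]) hx, Γ.inv_unit]
  transitive_left x y h := by
    obtain ⟨g, hg, hgx⟩ := Φ.transitive_right x y h
    exact ⟨Γ'.inv g, by rw [Γ'.tgt_inv, hg],
      (congrArg (Φ.right.act x) (Γ'.inv_inv g)).trans hgx⟩
  transitive_right x y h := by
    obtain ⟨g, hg, hgx⟩ := Φ.transitive_left x y h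
    exact ⟨Γ.inv g, by rw [Γ.src_inv, hg],
      (congrArg (Φ.left.act · x) (Γ.inv_inv g)).trans hgx⟩

theorem isOpenQuotientMap_p' : IsOpenQuotientMap Φ.p' := Φ.symm.isOpenQuotientMap_p

theorem symm_left_act_inv (x : Φ.X) (g : Γ'.Arr) :
    Φ.symm.left.act (Γ'.inv g) x = Φ.right.act x g :=
  congrArg (Φ.right.act x) (Γ'.inv_inv g)

theorem left_cancel {g h : Γ.Arr} {x : Φ.X} (hg : Γ.tgt g = Φ.p x) (hh : Γ.tgt h = Φ.p x)
    (hgh : Φ.left.act g x = Φ.left.act h x) : g = h := by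
  have hsrc : Γ.src g = Γ.src h := by
    rw [← Φ.left.moment_act _ _ hg, hgh, Φ.left.moment_act _ _ hh]
  have htgt : Γ.tgt (Γ.inv h) = Γ.src g := by rw [Γ.tgt_inv, hsrc]
  have hunit : Γ.mul (Γ.inv h) g = Γ.unit (Φ.p x) := by
    refine Φ.free_left _ _ (by rw [Γ.tgt_mul _ _ htgt, hg]) ?_
    rw [Φ.left.mul_act _ _ _ htgt hg, hgh, ← Φ.left.mul_act _ _ _ (Γ.tgt_inv h) hh, Γ.inv_mul, hh,
      Φ.left.unit_act]
  rw [Γ.eq_inv_of_mul_eq_unit htgt (by rw [hunit, Γ.src_inv, hh]), Γ.inv_inv]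

theorem isClosedEmbedding_left : IsClosedEmbedding
    (fun q : {q : Γ.Arr × Φ.X // Γ.tgt q.1 = Φ.p q.2} => (Φ.left.act q.1.1 q.1.2, q.1.2)) := by
  refine .of_continuous_injective_isClosedMap Φ.proper_left.continuous ?_ Φ.proper_left.isClosedMap
  rintro ⟨⟨g, x⟩, hg⟩ ⟨⟨h, y⟩, hh⟩ hgh
  obtain ⟨hact, rfl⟩ := Prod.ext_iff.1 hgh
  exact Subtype.ext (Prod.ext (Φ.left_cancel hg hh hact) rfl)

theorem tendsto_of_tendsto_left_act {T : Type*} {l : Filter T} {a : T → Φ.X} {g : T → Γ.Arr}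
    {x₀ : Φ.X} {g₀ : Γ.Arr} (h : ∀ t, Γ.tgt (g t) = Φ.p (a t)) (h₀ : Γ.tgt g₀ = Φ.p x₀)
    (ha : Tendsto a l (𝓝 x₀))
    (hga : Tendsto (fun t => Φ.left.act (g t) (a t)) l (𝓝 (Φ.left.act g₀ x₀))) :
    Tendsto g l (𝓝 g₀) := by
  have hpair : Tendsto (fun t => (⟨(g t, a t), h t⟩ : {q : Γ.Arr × Φ.X // Γ.tgt q.1 = Φ.p q.2})) l
      (𝓝 ⟨(g₀, x₀), h₀⟩) :=
    Φ.isClosedEmbedding_left.tendsto_nhds_iff.2 (hga.prodMk_nhds ha)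
  exact (continuous_fst.comp continuous_subtype_val).continuousAt.tendsto.comp hpair

theorem right_cancel {g h : Γ'.Arr} {x : Φ.X} (hg : Φ.p' x = Γ'.src g) (hh : Φ.p' x = Γ'.src h)
    (hgh : Φ.right.act x g = Φ.right.act x h) : g = h := by
  rw [← Γ'.inv_inv g, ← Γ'.inv_inv h]
  refine congrArg Γ'.inv (Φ.symm.left_cancel (x := x) ((Γ'.tgt_inv g).trans hg.symm)
    ((Γ'.tgt_inv h).trans hh.symm) ?_)
  rwa [symm_left_act_inv, symm_left_act_inv]

theorem continuous_of_continuous_right_act {T : Type*} [TopologicalSpace T] {a : T → Φ.X}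
    {g : T → Γ'.Arr} (h : ∀ t, Φ.p' (a t) = Γ'.src (g t)) (ha : Continuous a)
    (hga : Continuous fun t => Φ.right.act (a t) (g t)) : Continuous g := by
  have htgt (t : T) : Γ'.tgt (Γ'.inv (g t)) = Φ.symm.p (a t) := (Γ'.tgt_inv _).trans (h t).symm
  have hinv : Continuous fun t => Γ'.inv (g t) := by
    refine continuous_iff_continuousAt.2 fun t =>
      Φ.symm.tendsto_of_tendsto_left_act htgt (htgt t) (ha.tendsto t) ?_
    simp only [symm_left_act_inv]
    exact hga.tendsto t
  simpa only [Function.comp_def, Γ'.inv_inv] using Γ'.continuous_inv.comp hinv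

end LieMoritaEquivalence

section SmoothComposition

variable {𝕜 : Type*} [NontriviallyNormedField 𝕜]
  {E : Type*} [NormedAddCommGroup E] [NormedSpace 𝕜 E] {H : Type*} [TopologicalSpace H]
  {E' : Type*} [NormedAddCommGroup E'] [NormedSpace 𝕜 E'] {H' : Type*} [TopologicalSpace H']
  {E'' : Type*} [NormedAddCommGroup E''] [NormedSpace 𝕜 E''] {H'' : Type*} [TopologicalSpace H'']
  {I : ModelWithCorners 𝕜 E H} {J : ModelWithCorners 𝕜 E' H'} {K : ModelWithCorners 𝕜 E'' H''}
  {M : Type*} [TopologicalSpace M] [ChartedSpace H M]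
  {N : Type*} [TopologicalSpace N] [ChartedSpace H' N]
  {P : Type*} [TopologicalSpace P] [ChartedSpace H'' P]

theorem contMDiffAt_comp_of_eventually_mem {n : WithTop ℕ∞} {g : N → P} {s : Set N}
    (hg : ContMDiffOn J K n g s) {f : M → N} {x : M} (hf : ContMDiffAt I J n f x)
    (h : ∀ᶠ y in 𝓝 x, f y ∈ s) : ContMDiffAt I K n (fun y => g (f y)) x :=
  ((hg _ h.self_of_nhds).comp' x hf.contMDiffWithinAt).contMDiffAt (by rwa [univ_inter])

end SmoothComposition

section LocalSections

variable {𝕜 : Type v} [RCLike 𝕜] {Γ : LieGroupoid.{v, u} 𝕜}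

/-- The left action of a Lie groupoid on its arrows by multiplication. -/
def LieGroupoid.leftModule (Γ : LieGroupoid.{v, u} 𝕜) : LeftModule Γ Γ.Arr Γ.src where
  act := Γ.mul
  moment_act := Γ.src_mul
  unit_act := Γ.unit_mul
  mul_act := Γ.mul_assoc
  smooth_act := Γ.smooth_mul

variable {m : Γ.Obj} (c : SubmersionChart Γ.Arr.I Γ.Obj.I Γ.tgt (Γ.unit m))

/-- A smooth family `n ↦ localSection c (k, n)` of local sections of `tgt` near `m`, extending the
arrows `c.fib k` with target `m`. The section of parameter `0` is `Γ.unit`. -/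
noncomputable def localSection (q : c.F × Γ.Obj) : Γ.Arr :=
  c.e.symm (q.2, q.1 + c.coord (Γ.unit q.2))

theorem contMDiffAt_localSection_coords :
    ContMDiffAt (𝓘(𝕜, c.F).prod Γ.Obj.I) (Γ.Obj.I.prod 𝓘(𝕜, c.F)) ∞
      (fun q : c.F × Γ.Obj => (q.2, q.1 + c.coord (Γ.unit q.2))) (0, m) :=
  contMDiffAt_snd.prodMk (contMDiffAt_fst.add
    (ContMDiffAt.comp (g := c.coord) (f := fun q : c.F × Γ.Obj => Γ.unit q.2) _
      c.contMDiffAt_coord (Γ.smooth_unit.comp contMDiff_snd).contMDiffAt))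

theorem eventually_localSection_coords_mem :
    ∀ᶠ q in 𝓝 ((0 : c.F), m), (q.2, q.1 + c.coord (Γ.unit q.2)) ∈ c.e.target :=
  (contMDiffAt_localSection_coords c).continuousAt.eventually_mem <| by
    simpa only [c.coord_base, add_zero, Γ.tgt_unit] using c.target_mem_nhds

theorem contMDiffAt_localSection :
    ContMDiffAt (𝓘(𝕜, c.F).prod Γ.Obj.I) Γ.Arr.I ∞ (localSection c) (0, m) :=
  contMDiffAt_comp_of_eventually_mem c.contMDiffOn_symm (contMDiffAt_localSection_coords c)
    (eventually_localSection_coords_mem c)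

theorem eventually_tgt_localSection :
    ∀ᶠ q in 𝓝 ((0 : c.F), m), Γ.tgt (localSection c q) = q.2 :=
  (eventually_localSection_coords_mem c).mono fun _ hq => c.f_symm hq

theorem eventually_localSection_zero : ∀ᶠ n in 𝓝 m, localSection c (0, n) = Γ.unit n := by
  filter_upwards [Γ.smooth_unit.continuous.continuousAt.eventually_mem c.source_mem_nhds] with n hn
  have hunit := c.symm_eq hn
  rwa [Γ.tgt_unit, ← zero_add (c.coord _)] at hunit

theorem localSection_base (k : c.F) : localSection c (k, m) = c.fib k := by
  rw [localSection, c.coord_base, add_zero, SubmersionChart.fib, Γ.tgt_unit]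

theorem eventually_tgt_fib : ∀ᶠ k in 𝓝 0, Γ.tgt (c.fib k) = m :=
  c.eventually_f_fib.mono fun k hk => by rw [hk, Γ.tgt_unit]

end LocalSections

namespace LeftModule

variable {𝕜 : Type v} [RCLike 𝕜] {Γ : LieGroupoid.{v, u} 𝕜} {X : Mfd.{v, w} 𝕜} {p : X → Γ.Obj}
  (A : LeftModule Γ X p) {m : Γ.Obj} (c : SubmersionChart Γ.Arr.I Γ.Obj.I Γ.tgt (Γ.unit m))
  {N : Mfd.{v, u} 𝕜} {f : X → N} {z : X} (d : SubmersionChart X.I N.I f z)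

/-- The local translations of `X` by the sections `localSection c`. -/
noncomputable def translate (q : c.F × X) : X := A.act (localSection c (q.1, p q.2)) q.2

theorem eventually_tgt_localSection_moment (hp : ContinuousAt p z) (hz : p z = m) :
    ∀ᶠ q in 𝓝 ((0 : c.F), z), Γ.tgt (localSection c (q.1, p q.2)) = p q.2 := by
  subst hz
  exact (continuousAt_fst.prodMk
    (hp.comp continuousAt_snd : ContinuousAt (fun q : c.F × X => p q.2) (0, z))).eventually
    (eventually_tgt_localSection c)

theorem contMDiffAt_translate (hp : ContMDiffAt X.I Γ.Obj.I ∞ p z) (hz : p z = m) :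
    ContMDiffAt (𝓘(𝕜, c.F).prod X.I) X.I ∞ (A.translate c) (0, z) := by
  have hsec : ContMDiffAt (𝓘(𝕜, c.F).prod X.I) Γ.Arr.I ∞
      (fun q : c.F × X => localSection c (q.1, p q.2)) (0, z) :=
    ContMDiffAt.comp_of_eq (g := localSection c) (f := fun q : c.F × X => (q.1, p q.2))
      (contMDiffAt_localSection c)
      (contMDiffAt_fst.prodMk (hp.comp ((0 : c.F), z) contMDiffAt_snd)) (by rw [hz])
  exact contMDiffAt_comp_of_eventually_mem A.smooth_act (hsec.prodMk contMDiffAt_snd)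
    (eventually_tgt_localSection_moment c hp.continuousAt hz)

theorem eventually_translate_zero (hp : ContinuousAt p z) (hz : p z = m) :
    ∀ᶠ y in 𝓝 z, A.translate c (0, y) = y := by
  subst hz
  filter_upwards [hp.eventually (eventually_localSection_zero c)] with y hy
  rw [translate, hy, A.unit_act]

theorem translate_base_zero (hz : p z = m) : A.translate c (0, z) = z := by
  subst hz
  rw [translate, localSection_base, c.fib_zero, A.unit_act]

/-- The local translations in the coordinates of the fibre of a submersion chart. -/
noncomputable def translateCoord (q : c.F × d.F) : d.F := d.coord (A.translate c (q.1, d.fib q.2))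

theorem contDiffAt_translateCoord (hp : ContMDiffAt X.I Γ.Obj.I ∞ p z) (hz : p z = m) :
    ContDiffAt 𝕜 ∞ (A.translateCoord c d) (0, 0) := by
  have hfib : ContMDiffAt 𝓘(𝕜, c.F × d.F) (𝓘(𝕜, c.F).prod X.I) ∞
      (fun q : c.F × d.F => (q.1, d.fib q.2)) (0, 0) :=
    contDiff_fst.contMDiff.contMDiffAt.prodMk
      (ContMDiffAt.comp (g := d.fib) _ d.contMDiffAt_fib contDiff_snd.contMDiff.contMDiffAt)
  have htrans : ContMDiffAt 𝓘(𝕜, c.F × d.F) X.I ∞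
      (fun q : c.F × d.F => A.translate c (q.1, d.fib q.2)) (0, 0) :=
    ContMDiffAt.comp_of_eq (g := A.translate c) (f := fun q : c.F × d.F => (q.1, d.fib q.2))
      (A.contMDiffAt_translate c hp hz) hfib (by rw [d.fib_zero])
  exact (ContMDiffAt.comp_of_eq (g := d.coord) d.contMDiffAt_coord htrans
    (by rw [d.fib_zero, A.translate_base_zero c hz])).contDiffAt

theorem eventually_translateCoord_zero_left (hp : ContinuousAt p z) (hz : p z = m) :
    ∀ᶠ b in 𝓝 0, A.translateCoord c d (0, b) = b := by
  filter_upwards [d.tendsto_fib.eventually (A.eventually_translate_zero c hp hz),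
    d.eventually_coord_fib] with b hb hb'
  rw [translateCoord, hb, hb']

theorem eventually_leftModule_translateCoord_zero_right :
    ∀ᶠ k in 𝓝 0, Γ.leftModule.translateCoord c c (k, 0) = k := by
  filter_upwards [c.eventually_coord_fib, eventually_tgt_fib c] with k hk htgt
  have hmul : Γ.leftModule.translate c (k, Γ.unit m) = c.fib k :=
    calc Γ.leftModule.translate c (k, Γ.unit m)
        = Γ.mul (localSection c (k, m)) (Γ.unit m) :=
          congrArg (fun n => Γ.mul (localSection c (k, n)) (Γ.unit m)) (Γ.src_unit m)
      _ = Γ.mul (c.fib k) (Γ.unit (Γ.tgt (c.fib k))) := by rw [localSection_base, htgt]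
      _ = c.fib k := Γ.mul_unit _
  rw [LeftModule.translateCoord, c.fib_zero, hmul, hk]

end LeftModule

namespace LieMoritaEquivalence

variable {𝕜 : Type v} [RCLike 𝕜] {Γ Γ' : LieGroupoid.{v, u} 𝕜}
  (Φ : LieMoritaEquivalence.{v, u, w} Γ Γ') {x : Φ.X}
  (c : SubmersionChart Γ.Arr.I Γ.Obj.I Γ.tgt (Γ.unit (Φ.p x)))
  (d : SubmersionChart Φ.X.I Γ'.Obj.I Φ.p' x)

/-- The orbit map `γ ↦ γ · x`, in the coordinates of the fibre of `tgt`. -/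
noncomputable def orbitMap (k : c.F) : Φ.X := Φ.left.act (c.fib k) x

theorem orbitMap_zero : Φ.orbitMap c 0 = x := by
  rw [orbitMap, c.fib_zero, Φ.left.unit_act]

theorem eventually_p_orbitMap : ∀ᶠ k in 𝓝 0, Φ.p (Φ.orbitMap c k) = Γ.src (c.fib k) :=
  (eventually_tgt_fib c).mono fun _ hk => Φ.left.moment_act _ _ hk

theorem eventually_p'_orbitMap : ∀ᶠ k in 𝓝 0, Φ.p' (Φ.orbitMap c k) = Φ.p' x :=
  (eventually_tgt_fib c).mono fun _ hk => Φ.p'_left _ _ hk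

theorem contMDiffAt_orbitMap : ContMDiffAt 𝓘(𝕜, c.F) Φ.X.I ∞ (Φ.orbitMap c) 0 :=
  contMDiffAt_comp_of_eventually_mem Φ.left.smooth_act
    (c.contMDiffAt_fib.prodMk contMDiffAt_const) (eventually_tgt_fib c)

theorem tendsto_orbitMap : Tendsto (Φ.orbitMap c) (𝓝 0) (𝓝 x) := by
  simpa only [ContinuousAt, Φ.orbitMap_zero c] using (Φ.contMDiffAt_orbitMap c).continuousAt

/-- The orbit map, as a map from the fibre of `tgt` to the fibre of `p'`, in coordinates. -/
noncomputable def orbitCoord (k : c.F) : d.F := d.coord (Φ.orbitMap c k)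

theorem orbitCoord_zero : Φ.orbitCoord c d 0 = 0 := by
  rw [orbitCoord, orbitMap_zero, d.coord_base]

theorem contDiffAt_orbitCoord : ContDiffAt 𝕜 ∞ (Φ.orbitCoord c d) 0 :=
  (ContMDiffAt.comp_of_eq (g := d.coord) d.contMDiffAt_coord (Φ.contMDiffAt_orbitMap c)
    (Φ.orbitMap_zero c)).contDiffAt

theorem eventually_fib_orbitCoord :
    ∀ᶠ k in 𝓝 0, d.fib (Φ.orbitCoord c d k) = Φ.orbitMap c k := by
  filter_upwards [(Φ.tendsto_orbitMap c).eventually d.source_mem_nhds,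
    Φ.eventually_p'_orbitMap c] with k hk hk' using d.fib_coord hk hk'

theorem exists_tendsto_act_eq_fib : ∃ γ : d.F → Γ.Arr, Tendsto γ (𝓝 0) (𝓝 (Γ.unit (Φ.p x))) ∧
    ∀ᶠ b in 𝓝 0, Γ.tgt (γ b) = Φ.p x ∧ Φ.left.act (γ b) x = d.fib b := by
  classical
  let z (b : d.F) : Φ.X := if Φ.p' (d.fib b) = Φ.p' x then d.fib b else x
  have hz : ∀ᶠ b in 𝓝 0, z b = d.fib b := d.eventually_f_fib.mono fun b hb => if_pos hb
  have hzx (b : d.F) : Φ.p' x = Φ.p' (z b) := by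
    by_cases h : Φ.p' (d.fib b) = Φ.p' x
    · simp only [z, if_pos h, h]
    · simp only [z, if_neg h]
  choose γ hγ hγz using fun b => Φ.transitive_left x (z b) (hzx b)
  refine ⟨γ, Φ.tendsto_of_tendsto_left_act (a := fun _ => x) hγ (Γ.tgt_unit _)
    tendsto_const_nhds ?_, hz.mono fun b hb => ⟨hγ b, (hγz b).trans hb⟩⟩
  simp only [hγz, Φ.left.unit_act]
  exact d.tendsto_fib.congr' (hz.mono fun b hb => hb.symm)

theorem exists_rightInverse_orbitCoord :
    ∃ g : d.F → c.F, Tendsto g (𝓝 0) (𝓝 0) ∧ ∀ᶠ b in 𝓝 0, Φ.orbitCoord c d (g b) = b := by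
  obtain ⟨γ, hγ, hγx⟩ := Φ.exists_tendsto_act_eq_fib d
  refine ⟨fun b => c.coord (γ b), ?_, ?_⟩
  · have hcoord := c.contMDiffAt_coord.continuousAt.tendsto
    rw [c.coord_base] at hcoord
    exact hcoord.comp hγ
  · filter_upwards [hγx, hγ.eventually c.source_mem_nhds, d.eventually_coord_fib]
      with b ⟨htgt, hact⟩ hsource hb
    rw [orbitCoord, orbitMap, c.fib_coord hsource (htgt.trans (Γ.tgt_unit _).symm), hact, hb]

theorem eventually_orbitCoord_translateCoord :
    ∀ᶠ q in 𝓝 ((0 : c.F), (0 : c.F)), Φ.orbitCoord c d (Γ.leftModule.translateCoord c c q) =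
      Φ.left.translateCoord c d (q.1, Φ.orbitCoord c d q.2) := by
  have hunit : Γ.src (Γ.unit (Φ.p x)) = Φ.p x := Γ.src_unit _
  have hsnd : Tendsto Prod.snd (𝓝 ((0 : c.F), (0 : c.F))) (𝓝 0) := continuous_snd.tendsto _
  have hfib : Tendsto (fun q : c.F × c.F => (q.1, c.fib q.2)) (𝓝 (0, 0))
      (𝓝 (0, Γ.unit (Φ.p x))) :=
    (continuous_fst.tendsto _).prodMk_nhds (c.tendsto_fib.comp hsnd)
  have htranslate : Tendsto (fun q : c.F × c.F => Γ.leftModule.translate c (q.1, c.fib q.2))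
      (𝓝 (0, 0)) (𝓝 (Γ.unit (Φ.p x))) := by
    have hcont := (Γ.leftModule.contMDiffAt_translate c
      Γ.submersion_src.contMDiff.contMDiffAt hunit).continuousAt.tendsto
    rw [Γ.leftModule.translate_base_zero c hunit] at hcont
    exact hcont.comp hfib
  filter_upwards [htranslate.eventually c.source_mem_nhds,
    hfib.eventually (LeftModule.eventually_tgt_localSection_moment c
      Γ.continuous_src.continuousAt hunit),
    hsnd.eventually (eventually_tgt_fib c), hsnd.eventually (Φ.eventually_fib_orbitCoord c d),
    hsnd.eventually (Φ.eventually_p_orbitMap c)] with q hsource hcomp htgt hcoord hp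
  have hmul : c.fib (Γ.leftModule.translateCoord c c q) =
      Γ.mul (localSection c (q.1, Γ.src (c.fib q.2))) (c.fib q.2) :=
    c.fib_coord hsource ((Γ.tgt_mul _ _ hcomp).trans (htgt.trans (Γ.tgt_unit _).symm))
  rw [orbitCoord, orbitMap, hmul, Φ.left.mul_act _ _ _ hcomp htgt, LeftModule.translateCoord,
    LeftModule.translate, hcoord, hp, orbitMap]

theorem surjective_fderiv_orbitCoord :
    Function.Surjective (fderiv 𝕜 (Φ.orbitCoord c d) 0) := by
  have hf := (Φ.contDiffAt_orbitCoord c d).of_le (m := 1) (by simp)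
  have hunit : Γ.src (Γ.unit (Φ.p x)) = Φ.p x := Γ.src_unit _
  have hξ := (Γ.leftModule.contDiffAt_translateCoord c c
    Γ.submersion_src.contMDiff.contMDiffAt hunit).of_le (m := 1) (by simp)
  have hβ := (Φ.left.contDiffAt_translateCoord c d
    Φ.submersion_p.contMDiff.contMDiffAt rfl).of_le (m := 1) (by simp)
  obtain ⟨g, hg, hfg⟩ := Φ.exists_rightInverse_orbitCoord c d
  refine surjective_fderiv_of_finrank_range_le (g := g) hf
    (eventually_finrank_range_fderiv_le_of_equivariant hf hξ (by rwa [Φ.orbitCoord_zero])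
      (Γ.leftModule.eventually_translateCoord_zero_left c c Γ.continuous_src.continuousAt hunit)
      (LeftModule.eventually_leftModule_translateCoord_zero_right c)
      (Φ.eventually_orbitCoord_translateCoord c d)) ?_ ?_
  all_goals rwa [Φ.orbitCoord_zero]

end LieMoritaEquivalence

namespace LieGroupoid

variable {𝕜 : Type v} [RCLike 𝕜] (Γ : LieGroupoid.{v, u} 𝕜)

theorem hasModelDerivAt_src (g : Γ.Arr) :
    HasModelDerivAt Γ.Arr.I Γ.Obj.I Γ.src g (modelDeriv Γ.Arr.I Γ.Obj.I Γ.src g) :=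
  .of_contMDiffAt Γ.submersion_src.contMDiff.contMDiffAt (by simp)

theorem hasModelDerivAt_tgt (g : Γ.Arr) :
    HasModelDerivAt Γ.Arr.I Γ.Obj.I Γ.tgt g (modelDeriv Γ.Arr.I Γ.Obj.I Γ.tgt g) :=
  .of_contMDiffAt Γ.submersion_tgt.contMDiff.contMDiffAt (by simp)

theorem hasModelDerivAt_inv (g : Γ.Arr) :
    HasModelDerivAt Γ.Arr.I Γ.Arr.I Γ.inv g (modelDeriv Γ.Arr.I Γ.Arr.I Γ.inv g) :=
  .of_contMDiffAt Γ.smooth_inv.contMDiffAt (by simp)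

theorem modelDeriv_src_modelDeriv_inv (m : Γ.Obj) (v : Γ.Arr.E) :
    modelDeriv Γ.Arr.I Γ.Obj.I Γ.src (Γ.unit m)
        (modelDeriv Γ.Arr.I Γ.Arr.I Γ.inv (Γ.unit m) v) =
      modelDeriv Γ.Arr.I Γ.Obj.I Γ.tgt (Γ.unit m) v :=
  congrArg (· v)
    (((Γ.hasModelDerivAt_src (Γ.unit m)).comp (Γ.hasModelDerivAt_inv _) (Γ.inv_unit m)).unique
      ((Γ.hasModelDerivAt_tgt _).congr (.of_forall Γ.src_inv)))

theorem modelDeriv_tgt_modelDeriv_inv (m : Γ.Obj) (v : Γ.Arr.E) :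
    modelDeriv Γ.Arr.I Γ.Obj.I Γ.tgt (Γ.unit m)
        (modelDeriv Γ.Arr.I Γ.Arr.I Γ.inv (Γ.unit m) v) =
      modelDeriv Γ.Arr.I Γ.Obj.I Γ.src (Γ.unit m) v :=
  congrArg (· v)
    (((Γ.hasModelDerivAt_tgt (Γ.unit m)).comp (Γ.hasModelDerivAt_inv _) (Γ.inv_unit m)).unique
      ((Γ.hasModelDerivAt_src _).congr (.of_forall Γ.tgt_inv)))

theorem orbitTangent_eq_map_src_ker_tgt (m : Γ.Obj) : Γ.orbitTangent m =
    Submodule.map (modelDeriv Γ.Arr.I Γ.Obj.I Γ.src (Γ.unit m)).toLinearMap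
      (LinearMap.ker (modelDeriv Γ.Arr.I Γ.Obj.I Γ.tgt (Γ.unit m)).toLinearMap) := by
  apply le_antisymm
  · rintro _ ⟨v, hv, rfl⟩
    exact ⟨_, (Γ.modelDeriv_tgt_modelDeriv_inv m v).trans hv, Γ.modelDeriv_src_modelDeriv_inv m v⟩
  · rintro _ ⟨v, hv, rfl⟩
    exact ⟨_, (Γ.modelDeriv_src_modelDeriv_inv m v).trans hv, Γ.modelDeriv_tgt_modelDeriv_inv m v⟩

end LieGroupoid

namespace LieMoritaEquivalence

variable {𝕜 : Type v} [RCLike 𝕜] {Γ Γ' : LieGroupoid.{v, u} 𝕜}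
  (Φ : LieMoritaEquivalence.{v, u, w} Γ Γ')

/-- The differential of `p`. -/
noncomputable def dp (x : Φ.X) : Φ.X.E →L[𝕜] Γ.Obj.E := modelDeriv Φ.X.I Γ.Obj.I Φ.p x

/-- The differential of `p'`. -/
noncomputable def dp' (x : Φ.X) : Φ.X.E →L[𝕜] Γ'.Obj.E := modelDeriv Φ.X.I Γ'.Obj.I Φ.p' x

theorem hasModelDerivAt_p (x : Φ.X) : HasModelDerivAt Φ.X.I Γ.Obj.I Φ.p x (Φ.dp x) :=
  .of_contMDiffAt Φ.submersion_p.contMDiff.contMDiffAt (by simp)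

theorem hasModelDerivAt_p' (x : Φ.X) : HasModelDerivAt Φ.X.I Γ'.Obj.I Φ.p' x (Φ.dp' x) :=
  .of_contMDiffAt Φ.submersion_p'.contMDiff.contMDiffAt (by simp)

theorem surjective_dp (x : Φ.X) : Function.Surjective (Φ.dp x) :=
  surjective_modelDeriv_of_isSubmersion Φ.submersion_p x

section OrbitMap

variable {Φ} {x : Φ.X} (c : SubmersionChart Γ.Arr.I Γ.Obj.I Γ.tgt (Γ.unit (Φ.p x)))
  (d : SubmersionChart Φ.X.I Γ'.Obj.I Φ.p' x)

/-- The differential at `0` of the orbit map. -/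
noncomputable def dOrbitMap : c.F →L[𝕜] Φ.X.E := modelDeriv 𝓘(𝕜, c.F) Φ.X.I (Φ.orbitMap c) 0

theorem hasModelDerivAt_orbitMap :
    HasModelDerivAt 𝓘(𝕜, c.F) Φ.X.I (Φ.orbitMap c) 0 (dOrbitMap c) :=
  .of_contMDiffAt (Φ.contMDiffAt_orbitMap c) (by simp)

theorem dp_dOrbitMap (v : c.F) : Φ.dp x (dOrbitMap c v) =
    modelDeriv Γ.Arr.I Γ.Obj.I Γ.src (Γ.unit (Φ.p x)) (c.dFib v) :=
  congrArg (· v)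
    (((Φ.hasModelDerivAt_p x).comp (hasModelDerivAt_orbitMap c) (Φ.orbitMap_zero c)).unique
      (((Γ.hasModelDerivAt_src _).comp c.hasModelDerivAt_fib c.fib_zero).congr
        (Φ.eventually_p_orbitMap c)))

theorem dp'_dOrbitMap (v : c.F) : Φ.dp' x (dOrbitMap c v) = 0 :=
  congrArg (· v)
    (((Φ.hasModelDerivAt_p' x).comp (hasModelDerivAt_orbitMap c) (Φ.orbitMap_zero c)).unique
      ((HasModelDerivAt.const (Φ.p' x) _).congr (Φ.eventually_p'_orbitMap c)))

theorem dOrbitMap_eq_dFib (v : c.F) :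
    dOrbitMap c v = d.dFib (fderiv 𝕜 (Φ.orbitCoord c d) 0 v) := by
  have hcoord : HasModelDerivAt 𝓘(𝕜, c.F) 𝓘(𝕜, d.F) (Φ.orbitCoord c d) 0
      (fderiv 𝕜 (Φ.orbitCoord c d) 0) :=
    ((Φ.contDiffAt_orbitCoord c d).differentiableAt (by simp)).hasFDerivAt.hasMFDerivAt
  exact congrArg (· v) ((hasModelDerivAt_orbitMap c).unique
    ((d.hasModelDerivAt_fib.comp hcoord (Φ.orbitCoord_zero c d)).congr
      ((Φ.eventually_fib_orbitCoord c d).mono fun k hk => hk.symm)))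

end OrbitMap

theorem range_dOrbitMap_eq_ker {x : Φ.X}
    (c : SubmersionChart Γ.Arr.I Γ.Obj.I Γ.tgt (Γ.unit (Φ.p x))) :
    LinearMap.range (dOrbitMap c).toLinearMap = LinearMap.ker (Φ.dp' x).toLinearMap := by
  obtain ⟨d⟩ := nonempty_submersionChart Φ.submersion_p' x
  apply le_antisymm
  · rintro _ ⟨v, rfl⟩
    exact dp'_dOrbitMap c v
  · intro w hw
    obtain ⟨v, hv⟩ := Φ.surjective_fderiv_orbitCoord c d (d.dCoord w)
    exact ⟨v, by rw [ContinuousLinearMap.coe_coe, dOrbitMap_eq_dFib c d, hv, d.dFib_dCoord hw]⟩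

theorem orbitTangent_eq (x : Φ.X) : Γ.orbitTangent (Φ.p x) =
    Submodule.map (Φ.dp x).toLinearMap (LinearMap.ker (Φ.dp' x).toLinearMap) := by
  obtain ⟨c⟩ := nonempty_submersionChart Γ.submersion_tgt (Γ.unit (Φ.p x))
  rw [Γ.orbitTangent_eq_map_src_ker_tgt, ← Φ.range_dOrbitMap_eq_ker c]
  apply le_antisymm
  · rintro _ ⟨v, hv, rfl⟩
    refine ⟨_, ⟨c.dCoord v, rfl⟩, (dp_dOrbitMap c _).trans ?_⟩
    rw [c.dFib_dCoord hv, ContinuousLinearMap.coe_coe]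
  · rintro _ ⟨_, ⟨v, rfl⟩, rfl⟩
    exact ⟨c.dFib v, c.modelDeriv_dFib v, (dp_dOrbitMap c v).symm⟩

end LieMoritaEquivalence

theorem eq_map_sup_map_iff_comap_eq {𝕜 E E' : Type*} [Ring 𝕜] [AddCommGroup E] [Module 𝕜 E]
    [AddCommGroup E'] [Module 𝕜 E'] {f : E →ₗ[𝕜] E'} (hf : Function.Surjective f)
    {T : Submodule 𝕜 E'} {A B : Submodule 𝕜 E} :
    T = Submodule.map f A ⊔ Submodule.map f B ↔ Submodule.comap f T = LinearMap.ker f ⊔ A ⊔ B := by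
  rw [← Submodule.map_sup, sup_assoc, sup_comm (LinearMap.ker f), ← Submodule.comap_map_eq]
  exact (Submodule.comap_injective_of_surjective hf).eq_iff.symm

theorem LieGroupoid.IsStable.orbit_subset_iff {𝕜 : Type v} [RCLike 𝕜] {Γ : LieGroupoid.{v, u} 𝕜}
    {S : Set Γ.Obj} (hS : Γ.IsStable S) {m : Γ.Obj} : Γ.orbit m ⊆ S ↔ m ∈ S := by
  refine ⟨fun h => h ⟨Γ.unit m, Γ.src_unit m, Γ.tgt_unit m⟩, ?_⟩
  rintro h _ ⟨g, rfl, rfl⟩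
  exact (hS g).2 h

namespace LieMoritaEquivalence

variable {𝕜 : Type v} [RCLike 𝕜] {Γ Γ' : LieGroupoid.{v, u} 𝕜}
  (Φ : LieMoritaEquivalence.{v, u, w} Γ Γ')

theorem preimage_image {S : Set Γ.Obj} (hS : Γ.IsStable S) : Φ.p' ⁻¹' Φ.image S = Φ.p ⁻¹' S := by
  refine Subset.antisymm ?_ (subset_preimage_image Φ.p' (Φ.p ⁻¹' S))
  rintro x ⟨y, hy, hxy⟩
  obtain ⟨g, hg, rfl⟩ := Φ.transitive_left y x hxy
  rw [mem_preimage, Φ.left.moment_act _ _ hg, ← hS, hg]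
  exact hy

theorem mem_image_iff {S : Set Γ.Obj} (hS : Γ.IsStable S) {x : Φ.X} :
    Φ.p' x ∈ Φ.image S ↔ Φ.p x ∈ S := Set.ext_iff.1 (Φ.preimage_image hS) x

theorem symm_image_image {S : Set Γ.Obj} (hS : Γ.IsStable S) : Φ.symm.image (Φ.image S) = S := by
  change Φ.p '' (Φ.p' ⁻¹' Φ.image S) = S
  rw [Φ.preimage_image hS, image_preimage_eq _ Φ.surjective_p]

theorem isStable_image {S : Set Γ.Obj} (hS : Γ.IsStable S) : Γ'.IsStable (Φ.image S) := by
  intro g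
  obtain ⟨x, hx⟩ := Φ.surjective_p' (Γ'.src g)
  rw [← Φ.right.moment_act x g hx, ← hx, Φ.mem_image_iff hS, Φ.mem_image_iff hS, Φ.p_right _ _ hx]

theorem closure_image {S : Set Γ.Obj} (hS : Γ.IsStable S) :
    closure (Φ.image S) = Φ.image (closure S) := by
  apply Φ.surjective_p'.preimage_injective
  rw [Φ.preimage_image hS.closure,
    Φ.isOpenQuotientMap_p'.isOpenMap.preimage_closure_eq_closure_preimage
      Φ.isOpenQuotientMap_p'.continuous,
    Φ.isOpenQuotientMap_p.isOpenMap.preimage_closure_eq_closure_preimage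
      Φ.isOpenQuotientMap_p.continuous, Φ.preimage_image hS]

theorem isEmbeddedSubmanifold_image_iff {S : Set Γ.Obj} (hS : Γ.IsStable S) :
    Γ'.Obj.IsEmbeddedSubmanifold (Φ.image S) ↔ Γ.Obj.IsEmbeddedSubmanifold S := by
  rw [← Mfd.isEmbeddedSubmanifold_preimage_iff Φ.submersion_p' Φ.surjective_p',
    Φ.preimage_image hS, Mfd.isEmbeddedSubmanifold_preimage_iff Φ.submersion_p Φ.surjective_p]

theorem p'_mem_orbit_of_p_mem_orbit {x y : Φ.X} (h : Φ.p y ∈ Γ.orbit (Φ.p x)) :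
    Φ.p' y ∈ Γ'.orbit (Φ.p' x) := by
  obtain ⟨g, hsrc, htgt⟩ := h
  obtain ⟨g', hg', hgg'⟩ := Φ.transitive_right x (Φ.left.act g y)
    (by rw [Φ.left.moment_act g y htgt, hsrc])
  exact ⟨g', hg'.symm, by rw [← Φ.right.moment_act x g' hg', hgg', Φ.p'_left g y htgt]⟩

theorem p'_mem_orbit_iff {x y : Φ.X} :
    Φ.p' y ∈ Γ'.orbit (Φ.p' x) ↔ Φ.p y ∈ Γ.orbit (Φ.p x) :=
  ⟨Φ.symm.p'_mem_orbit_of_p_mem_orbit, Φ.p'_mem_orbit_of_p_mem_orbit⟩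

end LieMoritaEquivalence

theorem LieSubgroupoid.isIn_iff {𝕜 : Type v} [RCLike 𝕜] {Γ : LieGroupoid.{v, u} 𝕜}
    {R : LieSubgroupoid Γ} {S : Set Γ.Obj} : R.IsIn S ↔
      Dense (R.inclObj ⁻¹' S) ∧ R.IsTransverse S ∧ R.MeetsOrbits S :=
  ⟨fun h => ⟨h.dense, h.transverse, h.meets⟩, fun h => ⟨h.1, h.2.1, h.2.2⟩⟩

theorem LieSubgroupoid.isSurjectiveIn_iff {𝕜 : Type v} [RCLike 𝕜] {Γ : LieGroupoid.{v, u} 𝕜}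
    {R : LieSubgroupoid Γ} {S : Set Γ.Obj} :
    R.IsSurjectiveIn S ↔ R.IsIn S ∧ R.MeetsOrbits (closure S) :=
  ⟨fun h => ⟨h.isIn, h.meets_closure⟩, fun h => ⟨h.1, h.2⟩⟩

theorem LieSubgroupoid.isFullIn_iff {𝕜 : Type v} [RCLike 𝕜] {Γ : LieGroupoid.{v, u} 𝕜}
    {R : LieSubgroupoid Γ} {S : Set Γ.Obj} : R.IsFullIn S ↔ R.IsIn S ∧
      ∀ g, Γ.src g ∈ range R.inclObj ∩ S → Γ.tgt g ∈ range R.inclObj ∩ S →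
        g ∈ range R.inclArr := by
  refine ⟨fun h => ⟨h.isIn, fun g hsrc htgt => ?_⟩,
    fun h => ⟨h.1, Set.ext fun g => ⟨And.right, fun hg => ⟨h.2 g hg.1 hg.2, hg⟩⟩⟩⟩
  exact (h.full.symm.subset ⟨hsrc, htgt⟩).1

namespace SubgroupoidMoritaEquivalence

variable {𝕜 : Type v} [RCLike 𝕜] {Γ Γ' : LieGroupoid.{v, u} 𝕜} {R : LieSubgroupoid Γ}
  {R' : LieSubgroupoid Γ'} (Φ : SubgroupoidMoritaEquivalence.{v, u, w} R R')

/-- The inverse Morita equivalence of Lie subgroupoids, obtained by inverting both `X` and `Y`. -/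
def symm : SubgroupoidMoritaEquivalence.{v, u, w} R' R where
  X := Φ.X.symm
  Y := Φ.Y.symm
  i := Φ.i
  immersion_i := Φ.immersion_i
  injective_i := Φ.injective_i
  p_i := Φ.p'_i
  p'_i := Φ.p_i
  equivariant := fun r (y : Φ.Y.X) r' h h' => by
    change Φ.i (Φ.Y.left.act (R.gpd.inv r') (Φ.Y.right.act y (R'.gpd.inv r))) =
      Φ.X.left.act (Γ.inv (R.inclArr r')) (Φ.X.right.act (Φ.i y) (Γ'.inv (R'.inclArr r)))
    have hp : R.gpd.tgt (R.gpd.inv r') = Φ.Y.p y := (R.gpd.tgt_inv r').trans h'.symm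
    have hp' : Φ.Y.p' y = R'.gpd.src (R'.gpd.inv r) := h.symm.trans (R'.gpd.src_inv r).symm
    rw [← Φ.Y.comm _ _ _ hp hp', Φ.equivariant _ _ _ hp hp', R.inv_incl, R'.inv_incl, Φ.X.comm]
    · rw [← R.inv_incl, R.tgt_incl, hp, Φ.p_i]
    · rw [← R'.inv_incl, R'.src_incl, ← hp', Φ.p'_i]

theorem i_left {r : R.gpd.Arr} {y : Φ.Y.X} (h : R.gpd.tgt r = Φ.Y.p y) :
    Φ.i (Φ.Y.left.act r y) = Φ.X.left.act (R.inclArr r) (Φ.i y) := by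
  have hY : Φ.Y.p' (Φ.Y.left.act r y) = Φ.Y.p' y := Φ.Y.p'_left _ _ h
  have hX : Φ.X.p' (Φ.X.left.act (R.inclArr r) (Φ.i y)) = R'.inclObj (Φ.Y.p' y) := by
    rw [Φ.X.p'_left _ _ (by rw [R.tgt_incl, h, Φ.p_i]), Φ.p'_i]
  have := Φ.equivariant r y (R'.gpd.unit (Φ.Y.p' y)) h (R'.gpd.src_unit _).symm
  rwa [R'.unit_incl, ← hX, Φ.X.right.act_unit, ← hY, Φ.Y.right.act_unit] at this

theorem i_right {y : Φ.Y.X} {r' : R'.gpd.Arr} (h : Φ.Y.p' y = R'.gpd.src r') :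
    Φ.i (Φ.Y.right.act y r') = Φ.X.right.act (Φ.i y) (R'.inclArr r') := by
  have := Φ.equivariant (R.gpd.unit (Φ.Y.p y)) y r' (R.gpd.tgt_unit _) h
  rwa [R.unit_incl, ← Φ.p_i, Φ.X.left.unit_act, Φ.Y.left.unit_act] at this

theorem dense_preimage_image_iff {S : Set Γ.Obj} (hS : Γ.IsStable S) :
    Dense (R'.inclObj ⁻¹' Φ.X.image S) ↔ Dense (R.inclObj ⁻¹' S) := by
  have hpreimage : Φ.Y.p' ⁻¹' (R'.inclObj ⁻¹' Φ.X.image S) = Φ.Y.p ⁻¹' (R.inclObj ⁻¹' S) := by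
    ext y
    simp only [mem_preimage, ← Φ.p_i, ← Φ.p'_i, Φ.X.mem_image_iff hS]
  rw [← Φ.Y.isOpenQuotientMap_p.dense_preimage_iff, ← hpreimage,
    Φ.Y.isOpenQuotientMap_p'.dense_preimage_iff]

theorem meetsOrbits_iff {T : Set Γ.Obj} (hT : Γ.IsStable T) :
    R.MeetsOrbits T ↔ ∀ x, Φ.X.p x ∈ T → ∃ y, Φ.X.p (Φ.i y) ∈ Γ.orbit (Φ.X.p x) := by
  simp only [LieSubgroupoid.MeetsOrbits, Φ.X.surjective_p.forall, hT.orbit_subset_iff, Φ.p_i,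
    Set.Nonempty, mem_inter_iff, exists_range_iff, Φ.Y.surjective_p.exists]

theorem meetsOrbits_image_iff {T : Set Γ.Obj} (hT : Γ.IsStable T) :
    R'.MeetsOrbits (Φ.X.image T) ↔ R.MeetsOrbits T := by
  rw [Φ.meetsOrbits_iff hT, Φ.symm.meetsOrbits_iff (Φ.X.isStable_image hT)]
  exact forall_congr' fun x => imp_congr (Φ.X.mem_image_iff hT)
    (exists_congr fun y => Φ.X.p'_mem_orbit_iff)

/-- The differential of `i`. -/
noncomputable def di (y : Φ.Y.X) : Φ.Y.X.E →L[𝕜] Φ.X.X.E := modelDeriv Φ.Y.X.I Φ.X.X.I Φ.i y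

theorem dp_di (y : Φ.Y.X) (v : Φ.Y.X.E) : Φ.X.dp (Φ.i y) (Φ.di y v) =
    modelDeriv R.gpd.Obj.I Γ.Obj.I R.inclObj (Φ.Y.p y) (Φ.Y.dp y v) := by
  have hi : HasModelDerivAt Φ.Y.X.I Φ.X.X.I Φ.i y (Φ.di y) :=
    .of_contMDiffAt Φ.immersion_i.contMDiff.contMDiffAt (by simp)
  have hincl : HasModelDerivAt R.gpd.Obj.I Γ.Obj.I R.inclObj (Φ.Y.p y) _ :=
    .of_contMDiffAt R.immersion_obj.contMDiff.contMDiffAt (by simp)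
  exact congrArg (· v) (((Φ.X.hasModelDerivAt_p (Φ.i y)).comp hi rfl).unique
    ((hincl.comp (Φ.Y.hasModelDerivAt_p y) rfl).congr (.of_forall Φ.p_i)))

theorem range_modelDeriv_inclObj (y : Φ.Y.X) :
    LinearMap.range (modelDeriv R.gpd.Obj.I Γ.Obj.I R.inclObj (Φ.Y.p y)).toLinearMap =
      Submodule.map (Φ.X.dp (Φ.i y)).toLinearMap (LinearMap.range (Φ.di y).toLinearMap) := by
  ext e
  constructor
  · rintro ⟨a, rfl⟩
    obtain ⟨v, rfl⟩ := Φ.Y.surjective_dp y a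
    exact ⟨_, ⟨v, rfl⟩, Φ.dp_di y v⟩
  · rintro ⟨_, ⟨v, rfl⟩, rfl⟩
    exact ⟨_, (Φ.dp_di y v).symm⟩

theorem isTransverse_iff (S : Set Γ.Obj) : R.IsTransverse S ↔ ∀ y, Φ.X.p (Φ.i y) ∈ S →
    Φ.X.X.tangentOfSubset (Φ.X.p ⁻¹' S) (Φ.i y) =
      LinearMap.ker (Φ.X.dp (Φ.i y)).toLinearMap ⊔ LinearMap.ker (Φ.X.dp' (Φ.i y)).toLinearMap ⊔
        LinearMap.range (Φ.di y).toLinearMap := by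
  change (∀ l, R.inclObj l ∈ S → Γ.Obj.tangentOfSubset S (R.inclObj l) =
    Γ.orbitTangent (R.inclObj l) ⊔
      LinearMap.range (modelDeriv R.gpd.Obj.I Γ.Obj.I R.inclObj l).toLinearMap) ↔ _
  rw [Φ.Y.surjective_p.forall]
  refine forall_congr' fun y => ?_
  rw [Φ.range_modelDeriv_inclObj, ← Φ.p_i]
  refine forall_congr' fun hy => ?_
  rw [Φ.X.orbitTangent_eq, eq_map_sup_map_iff_comap_eq (Φ.X.surjective_dp (Φ.i y)),
    ← Mfd.comap_modelDeriv_tangentOfSubset Φ.X.submersion_p hy]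
  rfl

theorem isTransverse_image_iff {S : Set Γ.Obj} (hS : Γ.IsStable S) :
    R'.IsTransverse (Φ.X.image S) ↔ R.IsTransverse S := by
  rw [Φ.isTransverse_iff, Φ.symm.isTransverse_iff, ← Φ.X.preimage_image hS]
  refine forall_congr' fun y => imp_congr (Φ.X.mem_image_iff hS) ?_
  rw [sup_comm (LinearMap.ker (Φ.X.dp (Φ.i y)).toLinearMap)]
  rfl

theorem isIn_image_iff {S : Set Γ.Obj} (hS : Γ.IsStable S) :
    R'.IsIn (Φ.X.image S) ↔ R.IsIn S := by
  simp only [LieSubgroupoid.isIn_iff, Φ.dense_preimage_image_iff hS, Φ.isTransverse_image_iff hS,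
    Φ.meetsOrbits_image_iff hS]

theorem isSurjectiveIn_image_iff {S : Set Γ.Obj} (hS : Γ.IsStable S) :
    R'.IsSurjectiveIn (Φ.X.image S) ↔ R.IsSurjectiveIn S := by
  simp only [LieSubgroupoid.isSurjectiveIn_iff, Φ.isIn_image_iff hS, Φ.X.closure_image hS,
    Φ.meetsOrbits_image_iff hS.closure]

theorem mem_range_inclArr_of_act_eq {y z : Φ.Y.X} {g : Γ.Arr} {g' : Γ'.Arr}
    (hg : Γ.tgt g = Φ.X.p (Φ.i z)) (hg' : Φ.X.p' (Φ.i y) = Γ'.src g')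
    (h : Φ.X.left.act g (Φ.i z) = Φ.X.right.act (Φ.i y) g') (hgR : g ∈ range R.inclArr) :
    g' ∈ range R'.inclArr := by
  obtain ⟨r, rfl⟩ := hgR
  have htgt : R.gpd.tgt r = Φ.Y.p z := R.injective_obj (by rw [← R.tgt_incl, hg, Φ.p_i])
  have hsrc : R.gpd.src r = Φ.Y.p y := R.injective_obj (by
    rw [← R.src_incl, ← Φ.X.left.moment_act _ _ hg, h, Φ.X.p_right _ _ hg', Φ.p_i])
  obtain ⟨r', hr', hyr'⟩ := Φ.Y.transitive_right y (Φ.Y.left.act r z)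
    (by rw [Φ.Y.left.moment_act _ _ htgt, hsrc])
  refine ⟨r', Φ.X.right_cancel (x := Φ.i y) (by rw [R'.src_incl, ← hr', Φ.p'_i]) hg' ?_⟩
  rw [← Φ.i_right hr', hyr', Φ.i_left htgt, h]

theorem isFullIn_image {S : Set Γ.Obj} (hS : Γ.IsStable S) (hR : R.IsFullIn S) :
    R'.IsFullIn (Φ.X.image S) := by
  obtain ⟨hIn, hfull⟩ := LieSubgroupoid.isFullIn_iff.1 hR
  refine LieSubgroupoid.isFullIn_iff.2 ⟨(Φ.isIn_image_iff hS).2 hIn, ?_⟩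
  rintro g' ⟨⟨l, hl⟩, hlS⟩ ⟨⟨m, hm⟩, hmS⟩
  obtain ⟨y, rfl⟩ := Φ.Y.surjective_p' l
  obtain ⟨z, rfl⟩ := Φ.Y.surjective_p' m
  rw [← Φ.p'_i] at hl hm
  rw [← hl, Φ.X.mem_image_iff hS] at hlS
  rw [← hm, Φ.X.mem_image_iff hS] at hmS
  obtain ⟨g, hg, hgz⟩ := Φ.X.transitive_left (Φ.i z) (Φ.X.right.act (Φ.i y) g')
    (by rw [Φ.X.right.moment_act _ _ hl, hm])
  have hsrc : Γ.src g = Φ.X.p (Φ.i y) := by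
    rw [← Φ.X.left.moment_act _ _ hg, hgz, Φ.X.p_right _ _ hl]
  refine Φ.mem_range_inclArr_of_act_eq hg hl hgz (hfull g ?_ ?_)
  · exact hsrc ▸ ⟨⟨_, (Φ.p_i y).symm⟩, hlS⟩
  · exact hg ▸ ⟨⟨_, (Φ.p_i z).symm⟩, hmS⟩

theorem isFullIn_image_iff {S : Set Γ.Obj} (hS : Γ.IsStable S) :
    R'.IsFullIn (Φ.X.image S) ↔ R.IsFullIn S :=
  ⟨fun h => Φ.X.symm_image_image hS ▸ Φ.symm.isFullIn_image (Φ.X.isStable_image hS) h,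
    Φ.isFullIn_image hS⟩

end SubgroupoidMoritaEquivalence

theorem isOpenMap_snd_pullback {A B C : Type*} [TopologicalSpace A] [TopologicalSpace B]
    [TopologicalSpace C] {f : A → C} {g : B → C} (hf : IsOpenMap f) (hg : Continuous g) :
    IsOpenMap (fun q : {q : A × B // f q.1 = g q.2} => q.1.2) := by
  rintro _ ⟨V, hV, rfl⟩
  rw [isOpen_iff_mem_nhds]
  rintro _ ⟨⟨⟨a, b⟩, hab⟩, habV, rfl⟩
  obtain ⟨u, v, hu, hv, ha, hb, huv⟩ := isOpen_prod_iff.1 hV a b habV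
  have hfu : g ⁻¹' (f '' u) ∈ 𝓝 b :=
    ((hf u hu).preimage hg).mem_nhds ⟨a, ha, hab⟩
  filter_upwards [hv.mem_nhds hb, hfu] with b' hb' ⟨a', ha', hab'⟩
  exact ⟨⟨(a', b'), hab'⟩, huv ⟨ha', hb'⟩, rfl⟩

theorem compactSpace_of_factorsThrough_isQuotientMap {E D Q : Type*} [TopologicalSpace E]
    [TopologicalSpace D] [TopologicalSpace Q] [CompactSpace D] {a : E → D} {b : E → Q}
    (ha : IsQuotientMap a) (hb : Continuous b) (hbs : Function.Surjective b)
    (hab : b.FactorsThrough a) : CompactSpace Q := by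
  obtain ⟨c, rfl⟩ : ∃ c : D → Q, b = c ∘ a :=
    ⟨_, (funext fun e => (hab (Function.surjInv_eq ha.surjective (a e))).symm :
      b = (b ∘ Function.surjInv ha.surjective) ∘ a)⟩
  exact hbs.of_comp.compactSpace (ha.continuous_iff.2 hb)

theorem exists_isCompact_image_eq_of_isOpenQuotientMap {X Y : Type*} [TopologicalSpace X]
    [TopologicalSpace Y] [WeaklyLocallyCompactSpace X] [T2Space Y] {f : X → Y}
    (hf : IsOpenQuotientMap f) {K : Set Y} (hK : IsCompact K) : ∃ C, IsCompact C ∧ f '' C = K := by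
  choose s hs using hf.surjective
  choose N hN hsN using fun y => exists_compact_mem_nhds (s y)
  obtain ⟨t, -, ht⟩ := hK.elim_nhds_subcover (fun y => f '' N y) fun y _ => by
    simpa only [hs] using hf.isOpenMap.image_mem_nhds (hsN y)
  refine ⟨(⋃ y ∈ t, N y) ∩ f ⁻¹' K,
    (t.isCompact_biUnion fun y _ => hN y).inter_right (hK.isClosed.preimage hf.continuous), ?_⟩
  rwa [image_inter_preimage, image_iUnion₂, inter_eq_right]

namespace LieSubgroupoid

variable {𝕜 : Type v} [RCLike 𝕜] {Γ : LieGroupoid.{v, u} 𝕜} (R : LieSubgroupoid Γ) (K : Set Γ.Obj)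

theorem equivalence_actRel : Equivalence (R.actRel K) where
  refl a := ⟨R.gpd.unit a.1.1, R.gpd.tgt_unit _, by
    rw [R.gpd.src_unit, R.unit_incl, a.2.1, Γ.unit_mul]⟩
  symm := by
    rintro a b ⟨r, hr, hb⟩
    refine ⟨R.gpd.inv r, by rw [R.gpd.tgt_inv, hb], ?_⟩
    rw [hb, R.inv_incl, Γ.inv_mul_cancel_left (by rw [R.tgt_incl, hr, a.2.1]), R.gpd.src_inv, hr]
  trans := by
    rintro a b c ⟨r, hr, hb⟩ ⟨s, hs, hc⟩
    rw [hb] at hs hc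
    refine ⟨R.gpd.mul s r, by rw [R.gpd.tgt_mul _ _ hs, hr], ?_⟩
    rw [hc, R.gpd.src_mul _ _ hs, R.mul_incl _ _ hs,
      Γ.mul_assoc _ _ _ (by rw [R.tgt_incl, R.src_incl, hs]) (by rw [R.tgt_incl, hr, a.2.1])]

/-- The action `(r, γ) ↦ r · γ` of `R` on `Γ_L^K`, on the space of composable pairs. -/
def actArrows (q : {q : R.gpd.Arr × R.ArrowsTo K // R.gpd.tgt q.1 = q.2.1.1}) : R.ArrowsTo K :=
  have hcomp : Γ.tgt (R.inclArr q.1.1) = Γ.src q.1.2.1.2 := by rw [R.tgt_incl, q.2, q.1.2.2.1]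
  ⟨(R.gpd.src q.1.1, Γ.mul (R.inclArr q.1.1) q.1.2.1.2), by
    rw [Γ.src_mul _ _ hcomp, R.src_incl], by rw [Γ.tgt_mul _ _ hcomp]; exact q.1.2.2.2⟩

theorem continuous_actArrows : Continuous (R.actArrows K) := by
  have hsrc := R.gpd.continuous_src
  have hincl := R.immersion_arr.contMDiff.continuous
  have hmul : Continuous fun q : {q : R.gpd.Arr × R.ArrowsTo K // R.gpd.tgt q.1 = q.2.1.1} =>
      Γ.mul (R.inclArr q.1.1) q.1.2.1.2 :=
    Γ.smooth_mul.continuousOn.comp_continuous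
      (f := fun q : {q : R.gpd.Arr × R.ArrowsTo K // R.gpd.tgt q.1 = q.2.1.1} =>
        (R.inclArr q.1.1, q.1.2.1.2)) (by fun_prop)
      fun q => (R.tgt_incl q.1.1).trans ((congrArg R.inclObj q.2).trans q.1.2.2.1)
  exact Continuous.subtype_mk (by fun_prop) _

theorem isOpenQuotientMap_mk_actRel : IsOpenQuotientMap (Quot.mk (R.actRel K)) := by
  refine ⟨Quot.mk_surjective, continuous_quot_mk, fun U hU => ?_⟩
  have hsaturation : Quot.mk (R.actRel K) ⁻¹' (Quot.mk (R.actRel K) '' U) =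
      (fun q : {q : R.gpd.Arr × R.ArrowsTo K // R.gpd.tgt q.1 = q.2.1.1} => q.1.2) ''
        (R.actArrows K ⁻¹' U) := by
    ext a
    constructor
    · rintro ⟨b, hb, hba⟩
      obtain ⟨r, hr, hrb⟩ := ((R.equivalence_actRel K).quot_mk_eq_iff a b).1 hba.symm
      refine ⟨⟨(r, a), hr⟩, ?_, rfl⟩
      rwa [mem_preimage, show R.actArrows K ⟨(r, a), hr⟩ = b from Subtype.ext hrb.symm]
    · rintro ⟨⟨⟨r, a⟩, hr⟩, hU, rfl⟩
      exact ⟨_, hU, (Quot.sound ⟨r, hr, rfl⟩).symm⟩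
  rw [← isQuotientMap_quot_mk.isOpen_preimage, hsaturation]
  exact isOpenMap_snd_pullback (isOpenMap_of_isSubmersion R.gpd.submersion_tgt)
    (continuous_fst.comp continuous_subtype_val) _ (hU.preimage (R.continuous_actArrows K))

/-- The target map on the quotient `R \ Γ_L^K`. -/
def quotTgt : Quot (R.actRel K) → Γ.Obj :=
  Quot.lift (fun a => Γ.tgt a.1.2) (by
    rintro a b ⟨r, hr, hb⟩
    rw [hb, Γ.tgt_mul _ _ (by rw [R.tgt_incl, hr, a.2.1])])

theorem continuous_quotTgt : Continuous (R.quotTgt K) :=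
  continuous_quot_lift _ (Γ.continuous_tgt.comp (continuous_snd.comp continuous_subtype_val))

end LieSubgroupoid

namespace LieMoritaEquivalence

variable {𝕜 : Type v} [RCLike 𝕜] {Γ Γ' : LieGroupoid.{v, u} 𝕜}
  (Φ : LieMoritaEquivalence.{v, u, w} Γ Γ') {x y : Φ.X}

/-- The division map of the right action: the unique arrow `g'` with `x · g' = y`, for two points
`x` and `y` of the same fibre of `p`. -/
noncomputable def rightDiv (h : Φ.p x = Φ.p y) : Γ'.Arr := (Φ.transitive_right x y h).choose

theorem p'_eq_src_rightDiv (h : Φ.p x = Φ.p y) : Φ.p' x = Γ'.src (Φ.rightDiv h) :=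
  (Φ.transitive_right x y h).choose_spec.1

theorem act_rightDiv (h : Φ.p x = Φ.p y) : Φ.right.act x (Φ.rightDiv h) = y :=
  (Φ.transitive_right x y h).choose_spec.2

theorem tgt_rightDiv (h : Φ.p x = Φ.p y) : Γ'.tgt (Φ.rightDiv h) = Φ.p' y := by
  rw [← Φ.right.moment_act _ _ (Φ.p'_eq_src_rightDiv h), Φ.act_rightDiv]

theorem rightDiv_eq (h : Φ.p x = Φ.p y) {g : Γ'.Arr} (hg : Φ.p' x = Γ'.src g)
    (hgy : Φ.right.act x g = y) : Φ.rightDiv h = g :=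
  Φ.right_cancel (Φ.p'_eq_src_rightDiv h) hg ((Φ.act_rightDiv h).trans hgy.symm)

theorem continuous_rightDiv {T : Type*} [TopologicalSpace T] {a b : T → Φ.X} (ha : Continuous a)
    (hb : Continuous b) (h : ∀ t, Φ.p (a t) = Φ.p (b t)) :
    Continuous fun t => Φ.rightDiv (h t) :=
  Φ.continuous_of_continuous_right_act (fun t => Φ.p'_eq_src_rightDiv (h t)) ha <| by
    simpa only [Φ.act_rightDiv] using hb

end LieMoritaEquivalence

namespace SubgroupoidMoritaEquivalence

variable {𝕜 : Type v} [RCLike 𝕜] {Γ Γ' : LieGroupoid.{v, u} 𝕜} {R : LieSubgroupoid Γ}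
  {R' : LieSubgroupoid Γ'} (Φ : SubgroupoidMoritaEquivalence.{v, u, w} R R')

/-- The space of triples `(y, γ, x)` with `x ∈ C` such that `γ · x` is defined and lies in the same
fibre of `p` as `i y`. The classes of `γ` and of the arrow `γ'` with `i y · γ' = γ · x` relate
`R \ Γ_L^K` and `R' \ Γ'_{L'}^{K'}` for `K = p(C)` and `K' = p'(C)`. -/
abbrev Comparison (C : Set Φ.X.X) := {e : Φ.Y.X × Γ.Arr × Φ.X.X //
  R.inclObj (Φ.Y.p e.1) = Γ.src e.2.1 ∧ Γ.tgt e.2.1 = Φ.X.p e.2.2 ∧ e.2.2 ∈ C}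

/-- The fibre product of `R \ Γ_L^K` and `C` over `K = p(C)`. -/
def QuotPullback (C : Set Φ.X.X) : Set (Quot (R.actRel (Φ.X.p '' C)) × C) :=
  {d | R.quotTgt (Φ.X.p '' C) d.1 = Φ.X.p d.2}

theorem compactSpace_quotPullback {C : Set Φ.X.X} (hC : IsCompact C)
    [CompactSpace (Quot (R.actRel (Φ.X.p '' C)))] : CompactSpace (Φ.QuotPullback C) := by
  have : CompactSpace C := isCompact_iff_compactSpace.1 hC
  have hclosed : IsClosed (Φ.QuotPullback C) :=
    isClosed_eq ((R.continuous_quotTgt _).comp continuous_fst)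
      (Φ.X.isOpenQuotientMap_p.continuous.comp (continuous_subtype_val.comp continuous_snd))
  exact isCompact_iff_compactSpace.1 hclosed.isCompact

namespace Comparison

variable {Φ} {C : Set Φ.X.X} (e : Φ.Comparison C)

theorem p_i_eq : Φ.X.p (Φ.i e.1.1) = Φ.X.p (Φ.X.left.act e.1.2.1 e.1.2.2) := by
  rw [Φ.p_i, e.2.1, Φ.X.left.moment_act _ _ e.2.2.1]

/-- The element `(p(y), γ)` of `Γ_L^K` underlying `(y, γ, x)`. -/
def arrow : R.ArrowsTo (Φ.X.p '' C) :=
  ⟨(Φ.Y.p e.1.1, e.1.2.1), e.2.1, e.1.2.2, e.2.2.2, e.2.2.1.symm⟩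

/-- The element `(p'(y), γ')` of `Γ'_{L'}^{K'}` determined by `i y · γ' = γ · x`. -/
noncomputable def arrow' : R'.ArrowsTo (Φ.X.p' '' C) :=
  ⟨(Φ.Y.p' e.1.1, Φ.X.rightDiv e.p_i_eq),
    (Φ.p'_i e.1.1).symm.trans (Φ.X.p'_eq_src_rightDiv e.p_i_eq),
    e.1.2.2, e.2.2.2, ((Φ.X.tgt_rightDiv e.p_i_eq).trans (Φ.X.p'_left _ _ e.2.2.1)).symm⟩

/-- The map `(y, γ, x) ↦ ([p(y), γ], x)`. -/
def toQuotPullback : Φ.QuotPullback C := ⟨(Quot.mk _ e.arrow, ⟨e.1.2.2, e.2.2.2⟩), e.2.2.1⟩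

theorem isOpenQuotientMap_toQuotPullback :
    IsOpenQuotientMap (toQuotPullback : Φ.Comparison C → Φ.QuotPullback C) := by
  let s : Set (R.gpd.Obj × Γ.Arr) := {q | R.inclObj q.1 = Γ.src q.2 ∧ Γ.tgt q.2 ∈ Φ.X.p '' C}
  have hquot := ((((R.isOpenQuotientMap_mk_actRel (Φ.X.p '' C)).comp
    ((Φ.Y.isOpenQuotientMap_p.prodMap .id).restrictPreimage s)).prodMap
      (IsOpenQuotientMap.id (X := C))).restrictPreimage (Φ.QuotPullback C))
  exact hquot.comp (Homeomorph.isOpenQuotientMap (X := Φ.Comparison C)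
    { toFun e := ⟨(⟨(e.1.1, e.1.2.1), e.arrow.2⟩, ⟨e.1.2.2, e.2.2.2⟩), e.2.2.1⟩
      invFun e := ⟨(e.1.1.1.1, e.1.1.1.2, e.1.2), e.1.1.2.1, e.2, e.1.2.2⟩
      left_inv _ := rfl
      right_inv _ := rfl
      continuous_toFun := by fun_prop
      continuous_invFun := by fun_prop })

theorem continuous_arrow' : Continuous (arrow' : Φ.Comparison C → _) := by
  have hi : Continuous Φ.i := Φ.immersion_i.contMDiff.continuous
  have hp' : Continuous Φ.Y.p' := Φ.Y.isOpenQuotientMap_p'.continuous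
  have hact : Continuous fun e : Φ.Comparison C => Φ.X.left.act e.1.2.1 e.1.2.2 :=
    Φ.X.left.smooth_act.continuousOn.comp_continuous
      (f := fun e : Φ.Comparison C => e.1.2) (by fun_prop) fun e => e.2.2.1
  have hdiv : Continuous fun e : Φ.Comparison C => Φ.X.rightDiv e.p_i_eq :=
    Φ.X.continuous_rightDiv (by fun_prop) hact p_i_eq
  exact Continuous.subtype_mk (by fun_prop) _

theorem surjective_arrow' : Function.Surjective (arrow' : Φ.Comparison C → _) := by
  rintro ⟨⟨l', g'⟩, hl', x, hx, hxg⟩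
  dsimp only at hl' hxg
  obtain ⟨y, rfl⟩ := Φ.Y.surjective_p' l'
  rw [← Φ.p'_i] at hl'
  obtain ⟨γ, hγ, hγx⟩ := Φ.X.transitive_left x (Φ.X.right.act (Φ.i y) g')
    (by rw [Φ.X.right.moment_act _ _ hl', hxg])
  have hsrc : R.inclObj (Φ.Y.p y) = Γ.src γ := by
    rw [← Φ.X.left.moment_act _ _ hγ, hγx, Φ.X.p_right _ _ hl', Φ.p_i]
  let e : Φ.Comparison C := ⟨(y, γ, x), hsrc, hγ, hx⟩
  exact ⟨e, Subtype.ext (Prod.ext rfl (Φ.X.rightDiv_eq e.p_i_eq hl' hγx.symm))⟩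

theorem actRel_arrow' {e₁ e₂ : Φ.Comparison C} (hx : e₁.1.2.2 = e₂.1.2.2)
    (h : R.actRel _ e₁.arrow e₂.arrow) : R'.actRel _ e₁.arrow' e₂.arrow' := by
  obtain ⟨r, (hr_tgt : R.gpd.tgt r = Φ.Y.p e₁.1.1), hr₂⟩ := h
  have hr_src : Φ.Y.p e₂.1.1 = R.gpd.src r := congrArg Prod.fst hr₂
  have hmul : e₂.1.2.1 = Γ.mul (R.inclArr r) e₁.1.2.1 := congrArg Prod.snd hr₂
  obtain ⟨r', hr', hyr'⟩ := Φ.Y.transitive_right e₂.1.1 (Φ.Y.left.act r e₁.1.1)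
    (by rw [Φ.Y.left.moment_act _ _ hr_tgt, hr_src])
  have htgt : R'.gpd.tgt r' = Φ.Y.p' e₁.1.1 := by
    rw [← Φ.Y.right.moment_act _ _ hr', hyr', Φ.Y.p'_left _ _ hr_tgt]
  have hcomp : Γ'.tgt (R'.inclArr r') = Γ'.src (Φ.X.rightDiv e₁.p_i_eq) := by
    rw [R'.tgt_incl, htgt, ← Φ.p'_i, Φ.X.p'_eq_src_rightDiv]
  have hi : Φ.X.p' (Φ.i e₂.1.1) = Γ'.src (R'.inclArr r') := by rw [R'.src_incl, ← hr', Φ.p'_i]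
  have hr_comp : Γ.tgt (R.inclArr r) = Γ.src e₁.1.2.1 := by rw [R.tgt_incl, hr_tgt, e₁.2.1]
  refine ⟨r', htgt, Prod.ext hr' (Φ.X.rightDiv_eq e₂.p_i_eq
    (hi.trans (Γ'.src_mul _ _ hcomp).symm) ?_)⟩
  calc Φ.X.right.act (Φ.i e₂.1.1) (Γ'.mul (R'.inclArr r') (Φ.X.rightDiv e₁.p_i_eq))
      = Φ.X.right.act (Φ.X.left.act (R.inclArr r) (Φ.i e₁.1.1)) (Φ.X.rightDiv e₁.p_i_eq) := by
        rw [Φ.X.right.act_mul _ _ _ hi hcomp, ← Φ.i_right hr', hyr', Φ.i_left hr_tgt]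
    _ = Φ.X.left.act (R.inclArr r) (Φ.X.left.act e₁.1.2.1 e₁.1.2.2) := by
        rw [Φ.X.comm _ _ _ (by rw [R.tgt_incl, hr_tgt, Φ.p_i]) (Φ.X.p'_eq_src_rightDiv _),
          Φ.X.act_rightDiv]
    _ = Φ.X.left.act e₂.1.2.1 e₂.1.2.2 := by
        rw [hmul, ← hx, Φ.X.left.mul_act _ _ _ hr_comp e₁.2.2.1]

end Comparison

theorem compactSpace_quot_image {C : Set Φ.X.X} (hC : IsCompact C)
    (hQ : CompactSpace (Quot (R.actRel (Φ.X.p '' C)))) :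
    CompactSpace (Quot (R'.actRel (Φ.X.p' '' C))) := by
  have := Φ.compactSpace_quotPullback hC
  refine compactSpace_of_factorsThrough_isQuotientMap
    (Comparison.isOpenQuotientMap_toQuotPullback (Φ := Φ) (C := C)).isQuotientMap
    (continuous_quot_mk.comp Comparison.continuous_arrow')
    (Quot.mk_surjective.comp Comparison.surjective_arrow') fun e₁ e₂ h => ?_
  have hclass : Quot.mk (R.actRel _) e₁.arrow = Quot.mk _ e₂.arrow := congrArg (fun d => d.1.1) h
  have hx : e₁.1.2.2 = e₂.1.2.2 := congrArg (fun d => (d.1.2 : Φ.X.X)) h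
  exact Quot.sound (Comparison.actRel_arrow' hx
    (((R.equivalence_actRel _).quot_mk_eq_iff _ _).1 hclass))

theorem isProperIn_image {S : Set Γ.Obj} (hS : Γ.IsStable S) (hR : R.IsProperIn S) :
    R'.IsProperIn (Φ.X.image S) := by
  refine ⟨(Φ.isIn_image_iff hS).2 hR.isIn, fun K' hK' hK'S => ?_⟩
  have : LocallyCompactSpace Φ.X.X := Manifold.locallyCompact_of_finiteDimensional Φ.X.X.I
  obtain ⟨C, hC, rfl⟩ :=
    exists_isCompact_image_eq_of_isOpenQuotientMap Φ.X.isOpenQuotientMap_p' hK'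
  refine Φ.compactSpace_quot_image hC
    (hR.compact _ (hC.image Φ.X.isOpenQuotientMap_p.continuous) ?_)
  rw [Φ.X.closure_image hS, image_subset_iff, Φ.X.preimage_image hS.closure] at hK'S
  exact image_subset_iff.2 hK'S

theorem isProperIn_image_iff {S : Set Γ.Obj} (hS : Γ.IsStable S) :
    R'.IsProperIn (Φ.X.image S) ↔ R.IsProperIn S :=
  ⟨fun h => Φ.X.symm_image_image hS ▸ Φ.symm.isProperIn_image (Φ.X.isStable_image hS) h,
    Φ.isProperIn_image hS⟩

end SubgroupoidMoritaEquivalence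

theorem mainTheorem6_general {𝕜 : Type v} [RCLike 𝕜] {Γ Γ' : LieGroupoid.{v, u} 𝕜}
    {R : LieSubgroupoid Γ} {R' : LieSubgroupoid Γ'}
    (Φ : SubgroupoidMoritaEquivalence.{v, u, w} R R') {S : Set Γ.Obj} (hS : Γ.IsStable S) :
    Γ'.IsStable (Φ.X.image S) ∧
    (Γ.Obj.IsEmbeddedSubmanifold S ↔ Γ'.Obj.IsEmbeddedSubmanifold (Φ.X.image S)) ∧
    (R.IsIn S ↔ R'.IsIn (Φ.X.image S)) ∧
    (R.IsSurjectiveIn S ↔ R'.IsSurjectiveIn (Φ.X.image S)) ∧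
    (R.IsFullIn S ↔ R'.IsFullIn (Φ.X.image S)) ∧
    (R.IsProperIn S ↔ R'.IsProperIn (Φ.X.image S)) :=
  ⟨Φ.X.isStable_image hS, (Φ.X.isEmbeddedSubmanifold_image_iff hS).symm,
    (Φ.isIn_image_iff hS).symm, (Φ.isSurjectiveIn_image_iff hS).symm,
    (Φ.isFullIn_image_iff hS).symm, (Φ.isProperIn_image_iff hS).symm⟩

theorem mainTheorem6 {𝕜 : Type v} [RCLike 𝕜] {Γ Γ' : LieGroupoid.{v, u} 𝕜}
    (R : LieSubgroupoid Γ) (R' : LieSubgroupoid Γ')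
    (Φ : SubgroupoidMoritaEquivalence.{v, u, w} R R')
    (S : Set Γ.Obj) (hS : Γ.Obj.IsEmbeddedSubmanifold S) (hstable : Γ.IsStable S) :
    (Γ'.Obj.IsEmbeddedSubmanifold (Φ.X.image S) ∧ Γ'.IsStable (Φ.X.image S)) ∧
    (R.IsIn S ↔ R'.IsIn (Φ.X.image S)) ∧
    (R.IsSurjectiveIn S ↔ R'.IsSurjectiveIn (Φ.X.image S)) ∧
    (R.IsFullIn S ↔ R'.IsFullIn (Φ.X.image S)) ∧
    (R.IsProperIn S ↔ R'.IsProperIn (Φ.X.image S)) :=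
  have ⟨hstable', hembedded, hiffs⟩ := mainTheorem6_general Φ hstable
  ⟨⟨hembedded.1 hS, hstable'⟩, hiffs⟩
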